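/- Let $\mathbb T^2=\mathbb R^2/\mathbb Z^2$ with Lebesgue measure. Let $H$ be the space of $u\in L^2(\mathbb T^2;\mathbb R^2)$ with $\int_{\mathbb T^2}u\,dx=0$ and $\nabla\cdot u=0$ (in the sense of distributions), with the $L^2$ scalar product $\langle\cdot,\cdot\rangle$ and norm $|\cdot|_H$; let $V=H\cap H^1(\mathbb T^2;\mathbb R^2)$ with the $H^1$ norm and $E=D(A)=H\cap H^2(\mathbb T^2;\mathbb R^2)$ with the $H^2$ norm. Let $A:E\to H$, $Au=-\Delta u$, be the Stokes operator, let $B(u,v)\in H$ be the orthogonal projection onto $H$ of $(u\cdot\nabla)v=\sum_i u^i\,\partial v/\partial x^i$ (so that $\langle B(u,v),\phi\rangle=\sum_{i,j}\int_{\mathbb T^2} u^i\frac{\partial v^j}{\partial x^i}\phi^j\,dx$ for $\phi\in V$), and put $B(u)=B(u,u)$ and $B'(\bar u)\omega=B(\bar u,\omega)+B(\omega,\bar u)$. Below, $|\nabla u|$ and $\langle\nabla u,\nabla v\rangle$ denote the $L^2$ norm and the $L^2$ scalar product of gradients. For $T>0$ let $X_T=C([0,T];V)\cap L^2(0,T;E)$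 with the norm $|\omega|_{X_T}=\max\big(\sup_{t}|\omega(t)|_V,\,(\int_0^T|\omega(t)|_E^2\,dt)^{1/2}\big)$. Then $(u\cdot\nabla)v\in L^2(\mathbb T^2;\mathbb R^2)$ for all $u,v\in E$, and the following hold for every steady state $\bar u$, that is, every $\bar u\in E$ with $A\bar u+B(\bar u)-|\nabla\bar u|^2\bar u=0$. 1. There are constants $C_1,C_2,C_3>0$, independent of $\bar u$, $T$ and $U$, such that for every $T>0$ and every $U\in L^2(0,T;H)$ the map $$\omega\mapsto G(\omega)=U-B'(\bar u)\omega+|\nabla\bar u|^2\omega+2\langle\nabla\bar u,\nabla\omega\rangle\bar u$$ is well defined from $X_T$ to $L^2(0,T;H)$ and globally Lipschitz: for all $\omega_1,\omega_2\in X_T$, $$|G(\omega_1)-G(\omega_2)|_{L^2(0,T;H)}\le\big(C_1|\nabla\bar u|^2+C_2|\bar u|_E+2C_3|\bar u|_H|\nabla\bar u|\big)\,|\omega_1-\omega_2|_{X_T}.$$ 2. The linearized system has a unique global solution: for every $T>0$, every $U\in L^2(0,T;H)$ and every $\omega_0\in V$ there is exactly one $\omega\in X_T$ with $\omega(0)=\omega_0$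 which is absolutely continuous in $H$ with derivative $\omega_t\in L^2(0,T;H)$ and satisfies $$\omega_t+A\omega+B'(\bar u)\omega-|\nabla\bar u|^2\omega-2\langle\nabla\bar u,\nabla\omega\rangle\bar u=U$$ in $H$ for almost every $t\in(0,T)$. Likewise, if $U:[0,\infty)\to H$ is square integrable on $[0,T]$ for every $T>0$, there is exactly one continuous $\omega:[0,\infty)\to V$ whose restriction to $[0,T]$ is, for every $T>0$, an element of $X_T$ and a solution in this sense. -/

import Mathlib

noncomputable section

namespace CNS

open MeasureTheory Set

/-! ### The flat torus and smooth functions on it -/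

/-- The flat two-dimensional torus `ℝ² / ℤ²`. -/
abbrev Torus : Type := UnitAddTorus (Fin 2)

/-- Lebesgue measure on the torus (of total mass one). -/
abbrev torusMeasure : Measure Torus := Measure.pi fun _ : Fin 2 => AddCircle.haarAddCircle

/-- The covering map `ℝ² → ℝ² / ℤ²`. -/
def cover (x : Fin 2 → ℝ) : Torus := fun i => (x i : UnitAddCircle)

/-- A function on the torus is smooth if its periodic lift to `ℝ²` is. -/
def IsSmooth (φ : Torus → ℝ) : Prop := ContDiff ℝ (⊤ : ℕ∞) fun x : Fin 2 → ℝ => φ (cover x)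

/-- The classical partial derivative `∂φ/∂xⁱ` of a function on the torus. -/
def pd (i : Fin 2) (φ : Torus → ℝ) (p : Torus) : ℝ :=
  deriv (fun s : ℝ => φ (p + Pi.single i (s : UnitAddCircle))) 0

/-! ### Vector fields and weak derivatives -/

abbrev Vec : Type := EuclideanSpace ℝ (Fin 2)

/-- `L²(𝕋²; ℝ²)`. -/
abbrev L2 : Type := Lp Vec 2 torusMeasure

/-- `g` is the weak partial derivative `∂u/∂xⁱ` of the vector field `u`. -/
def HasWeakPartial (i : Fin 2) (u g : L2) : Prop :=
  ∀ φ : Torus → ℝ, IsSmooth φ → ∀ j : Fin 2,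
    ∫ x, u x j * pd i φ x ∂torusMeasure = - ∫ x, g x j * φ x ∂torusMeasure

/-- `∇ · u = 0` in the sense of distributions. -/
def IsDivFree (u : L2) : Prop :=
  ∀ φ : Torus → ℝ, IsSmooth φ → ∑ j : Fin 2, ∫ x, u x j * pd j φ x ∂torusMeasure = 0

/-- `∫ u dx = 0`. -/
def HasMeanZero (u : L2) : Prop := ∀ j : Fin 2, ∫ x, u x j ∂torusMeasure = 0

/-! ### Auxiliary facts -/

lemma cover_surjective (p : Torus) : ∃ x, cover x = p := by
  choose x hx using fun i => QuotientAddGroup.mk_surjective (p i)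
  exact ⟨x, funext hx⟩

lemma isOpenQuotientMap_cover : IsOpenQuotientMap cover := by
  have h : cover = Pi.map (fun _ : Fin 2 => ((↑) : ℝ → UnitAddCircle)) := rfl
  rw [h]
  exact IsOpenQuotientMap.piMap fun _ => QuotientAddGroup.isOpenQuotientMap_mk

lemma IsSmooth.continuous {φ : Torus → ℝ} (h : IsSmooth φ) : Continuous φ :=
  isOpenQuotientMap_cover.isQuotientMap.continuous_iff.2 (ContDiff.continuous h)

lemma pd_cover {φ : Torus → ℝ} (h : IsSmooth φ) (i : Fin 2) (x : Fin 2 → ℝ) :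
    pd i φ (cover x) = fderiv ℝ (fun y => φ (cover y)) x (Pi.single i 1) := by
  have hd : DifferentiableAt ℝ (fun y => φ (cover y)) x :=
    (ContDiff.differentiable h (by simp)).differentiableAt
  have he : (fun s : ℝ => φ (cover x + Pi.single i (s : UnitAddCircle)))
      = fun s : ℝ => φ (cover (x + s • Pi.single i (1 : ℝ))) := by
    funext s
    congr 1
    funext j
    by_cases hj : j = i
    · subst hj; simp [cover]
    · simp [cover, hj]
  unfold pd
  rw [he]
  exact (hd.hasFDerivAt.hasLineDerivAt (Pi.single i 1)).lineDeriv

lemma IsSmooth.pd {φ : Torus → ℝ} (h : IsSmooth φ) (i : Fin 2) : IsSmooth (pd i φ) := by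
  unfold IsSmooth
  simp only [pd_cover h i]
  exact (ContDiff.fderiv_right (m := (⊤ : ℕ∞)) h (by simp)).clm_apply contDiff_const

lemma pd_comm {φ : Torus → ℝ} (h : IsSmooth φ) (i j : Fin 2) :
    pd i (pd j φ) = pd j (pd i φ) := by
  have key : ∀ (a b : Fin 2) (x : Fin 2 → ℝ), pd a (pd b φ) (cover x)
      = fderiv ℝ (fderiv ℝ fun y => φ (cover y)) x (Pi.single a 1) (Pi.single b 1) := by
    intro a b x
    rw [pd_cover (h.pd b) a]
    simp only [pd_cover h b]
    have hd : DifferentiableAt ℝ (fderiv ℝ fun y => φ (cover y)) x :=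
      ((ContDiff.fderiv_right (m := (⊤ : ℕ∞)) h (by simp)).differentiable (by simp)).differentiableAt
    rw [fderiv_clm_apply hd (differentiableAt_const _)]
    simp
  funext p
  obtain ⟨x, rfl⟩ := cover_surjective p
  rw [key, key]
  have hs : IsSymmSndFDerivAt ℝ (fun y => φ (cover y)) x :=
    (ContDiff.contDiffAt h).isSymmSndFDerivAt (by
      rw [minSmoothness_of_isRCLikeNormedField]; exact WithTop.coe_le_coe.2 le_top)
  exact hs _ _

lemma isSmooth_one : IsSmooth fun _ => 1 := contDiff_const

lemma pd_one (i : Fin 2) : pd i (fun _ => 1) = 0 := by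
  funext p; simp [pd]

/-- The continuous linear functional `u ↦ ∫ uʲ ψ dx`. -/
def pairing (j : Fin 2) (ψ : C(Torus, ℝ)) : L2 →L[ℝ] ℝ :=
  innerSL ℝ (ContinuousMap.toLp (E := Vec) 2 torusMeasure ℝ
    ⟨fun x => ψ x • EuclideanSpace.single j (1 : ℝ), by fun_prop⟩)

lemma pairing_apply (j : Fin 2) (ψ : C(Torus, ℝ)) (u : L2) :
    pairing j ψ u = ∫ x, u x j * ψ x ∂torusMeasure := by
  simp only [pairing, innerSL_apply_apply, L2.inner_def]
  refine integral_congr_ae ?_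
  filter_upwards [ContinuousMap.coeFn_toLp (E := Vec) (p := 2) (𝕜 := ℝ) torusMeasure
    ⟨fun x => ψ x • EuclideanSpace.single j (1 : ℝ), by fun_prop⟩] with x hx
  rw [hx]
  simp [real_inner_smul_left, EuclideanSpace.inner_single_left, mul_comm]

lemma hasWeakPartial_iff (i : Fin 2) (u g : L2) :
    HasWeakPartial i u g ↔ ∀ (φ : Torus → ℝ) (h : IsSmooth φ) (j : Fin 2),
      pairing j ⟨_, (h.pd i).continuous⟩ u + pairing j ⟨φ, h.continuous⟩ g = 0 := by
  simp only [HasWeakPartial, pairing_apply, ContinuousMap.coe_mk, eq_neg_iff_add_eq_zero]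

lemma isDivFree_iff (u : L2) :
    IsDivFree u ↔ ∀ (φ : Torus → ℝ) (h : IsSmooth φ),
      ∑ j : Fin 2, pairing j ⟨_, (h.pd j).continuous⟩ u = 0 := by
  simp only [IsDivFree, pairing_apply, ContinuousMap.coe_mk]

lemma hasMeanZero_iff (u : L2) : HasMeanZero u ↔ ∀ j : Fin 2, pairing j 1 u = 0 := by
  simp only [HasMeanZero, pairing_apply, ContinuousMap.one_apply, mul_one]

lemma HasWeakPartial.add {i : Fin 2} {u u' g g' : L2} (h : HasWeakPartial i u g)
    (h' : HasWeakPartial i u' g') : HasWeakPartial i (u + u') (g + g') := by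
  rw [hasWeakPartial_iff] at *
  intro φ hφ j
  have h1 := h φ hφ j
  have h2 := h' φ hφ j
  simp only [map_add]
  linarith

lemma HasWeakPartial.smul {i : Fin 2} {u g : L2} (c : ℝ) (h : HasWeakPartial i u g) :
    HasWeakPartial i (c • u) (c • g) := by
  rw [hasWeakPartial_iff] at *
  intro φ hφ j
  simp only [map_smul, ← smul_add, h φ hφ j, smul_zero]

lemma HasWeakPartial.zero (i : Fin 2) : HasWeakPartial i 0 0 := by
  rw [hasWeakPartial_iff]; intros; simp

/-! ### The spaces `H`, `V` and `E = D(A)` -/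

/-- The closed subspace of `L²(𝕋²; ℝ²)` of vector fields with mean zero and zero divergence. -/
def solenoidal : Submodule ℝ L2 where
  carrier := {u | HasMeanZero u ∧ IsDivFree u}
  add_mem' := by
    rintro u v ⟨hu, hu'⟩ ⟨hv, hv'⟩
    simp only [mem_ofPred_eq, hasMeanZero_iff, isDivFree_iff] at *
    refine ⟨fun j => by rw [map_add, hu, hv, add_zero], fun φ h => ?_⟩
    simp only [map_add, Finset.sum_add_distrib, hu' φ h, hv' φ h, add_zero]
  zero_mem' := by
    simp only [mem_ofPred_eq, hasMeanZero_iff, isDivFree_iff]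
    simp
  smul_mem' := by
    rintro c u ⟨hu, hu'⟩
    simp only [mem_ofPred_eq, hasMeanZero_iff, isDivFree_iff] at *
    refine ⟨fun j => by rw [map_smul, hu, smul_zero], fun φ h => ?_⟩
    simp only [map_smul, ← Finset.smul_sum, hu' φ h, smul_zero]

lemma isClosed_solenoidal : IsClosed (solenoidal : Set L2) := by
  have : (solenoidal : Set L2) = {u | (∀ j : Fin 2, pairing j 1 u = 0) ∧
      ∀ (φ : Torus → ℝ) (h : IsSmooth φ),
        ∑ j : Fin 2, pairing j ⟨_, (h.pd j).continuous⟩ u = 0} := by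
    ext u
    simp only [mem_ofPred_eq, ← hasMeanZero_iff, ← isDivFree_iff]
    rfl
  rw [this]
  simp only [ofPred_and, ofPred_forall]
  refine IsClosed.inter (isClosed_iInter fun j => isClosed_eq (by fun_prop) (by fun_prop))
    (isClosed_iInter fun φ => isClosed_iInter fun h => isClosed_eq (by fun_prop) (by fun_prop))

instance : CompleteSpace solenoidal := isClosed_solenoidal.completeSpace_coe

/-- The space `H` of square integrable vector fields with mean zero and zero divergence, with the
`L²` scalar product. -/
def H : Type := solenoidal

instance : NormedAddCommGroup H := inferInstanceAs (NormedAddCommGroup solenoidal)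
instance : InnerProductSpace ℝ H := inferInstanceAs (InnerProductSpace ℝ solenoidal)
instance : CompleteSpace H := inferInstanceAs (CompleteSpace solenoidal)

/-- The inclusion `H ⊂ L²(𝕋²; ℝ²)`. -/
def H.toL2 : H →L[ℝ] L2 := solenoidal.subtypeL

/-- The orthogonal projection of `L²(𝕋²; ℝ²)` onto `H`. -/
def H.proj : L2 →L[ℝ] H := solenoidal.orthogonalProjectionOnto

/-- Pairs of `L²` vector fields `(∂u/∂x¹, ∂u/∂x²)`, with the Hilbert norm. -/
abbrev Grads : Type := PiLp 2 fun _ : Fin 2 => L2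

/-- Quadruples of `L²` vector fields, with the Hilbert norm. -/
abbrev Hessians : Type := PiLp 2 fun _ : Fin 2 × Fin 2 => L2

/-- The graph of the weak gradient on `H¹ ∩ H`. -/
def graphV : Submodule ℝ (WithLp 2 (H × Grads)) where
  carrier := {w | ∀ i, HasWeakPartial i (H.toL2 w.fst) (w.snd i)}
  add_mem' := fun {_ _} hu hv i => (hu i).add (hv i)
  zero_mem' := fun i => HasWeakPartial.zero i
  smul_mem' := fun c _ hu i => (hu i).smul c

/-- The space `V = H¹ ∩ H`. An element of `V` is listed together with its two weak first partial
derivatives (which are determined by it), so that the inherited norm is the `H¹` norm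
`(|u|² + |∇u|²)^{1/2}`. -/
def V : Type := graphV

instance : NormedAddCommGroup V := inferInstanceAs (NormedAddCommGroup graphV)
instance : InnerProductSpace ℝ V := inferInstanceAs (InnerProductSpace ℝ graphV)

/-- The inclusion `V ⊂ H`. -/
def V.toH : V →L[ℝ] H := (WithLp.fstL 2 ℝ H Grads).comp graphV.subtypeL

/-- The gradient of `u ∈ V`: its `i`-th component is the vector field `∂u/∂xⁱ`. The norm and
inner product of the target are `|∇u|` and `⟨∇u, ∇v⟩` in `L²`. -/
def V.grad : V →L[ℝ] Grads := (WithLp.sndL 2 ℝ H Grads).comp graphV.subtypeL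

/-- The graph of the weak second derivatives on `H² ∩ H`. -/
def graphE : Submodule ℝ (WithLp 2 (V × Hessians)) where
  carrier := {w | ∀ i j, HasWeakPartial i (V.grad w.fst j) (w.snd (i, j))}
  add_mem' := fun {_ _} hu hv i j => (hu i j).add (hv i j)
  zero_mem' := fun i _ => HasWeakPartial.zero i
  smul_mem' := fun c _ hu i j => (hu i j).smul c

/-- The space `E = D(A) = H² ∩ H`. An element is listed together with its weak first and second
partial derivatives; the entry `(i, j)` of the latter is `∂/∂xⁱ (∂u/∂xʲ)`. The inherited norm is
the `H²` norm. -/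
def E : Type := graphE

instance : NormedAddCommGroup E := inferInstanceAs (NormedAddCommGroup graphE)
instance : InnerProductSpace ℝ E := inferInstanceAs (InnerProductSpace ℝ graphE)

/-- The inclusion `E ⊂ V`. -/
def E.toV : E →L[ℝ] V := (WithLp.fstL 2 ℝ V Hessians).comp graphE.subtypeL

/-- The inclusion `E ⊂ H`. -/
def E.toH : E →L[ℝ] H := V.toH.comp E.toV

/-- The gradient of an element of `E`. -/
def E.grad : E →L[ℝ] Grads := V.grad.comp E.toV

/-- The second derivative `∂/∂xⁱ (∂u/∂xʲ)`. -/
def E.hess (i j : Fin 2) : E →L[ℝ] L2 :=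
  (PiLp.proj 2 (fun _ : Fin 2 × Fin 2 => L2) (i, j)).comp
    ((WithLp.sndL 2 ℝ V Hessians).comp graphE.subtypeL)

/-! ### The Stokes operator and the bilinear map `B` -/

lemma H.isDivFree (u : H) : IsDivFree (H.toL2 u) := u.2.2

lemma V.weak (u : V) (i : Fin 2) : HasWeakPartial i (H.toL2 (V.toH u)) (V.grad u i) := u.2 i

lemma E.weak (u : E) (i j : Fin 2) : HasWeakPartial i (E.grad u j) (E.hess i j u) := u.2 i j

/-- `-Δ : E → L²`. -/
def negLaplacian : E →L[ℝ] L2 := - ∑ i : Fin 2, E.hess i i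

lemma pairing_hess (u : E) (i j : Fin 2) (φ : Torus → ℝ) (h : IsSmooth φ) :
    pairing j ⟨φ, h.continuous⟩ (E.hess i i u)
      = pairing j ⟨_, ((h.pd i).pd i).continuous⟩ (H.toL2 (E.toH u)) := by
  have e1 := (hasWeakPartial_iff _ _ _).1 (E.weak u i i) φ h j
  have e2 : pairing j ⟨_, ((h.pd i).pd i).continuous⟩ (H.toL2 (E.toH u))
      + pairing j ⟨_, (h.pd i).continuous⟩ (E.grad u i) = 0 :=
    (hasWeakPartial_iff _ _ _).1 (V.weak (E.toV u) i) _ (h.pd i) j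
  linarith

lemma negLaplacian_apply (u : E) :
    negLaplacian u = -(E.hess 0 0 u + E.hess 1 1 u) := by
  simp only [negLaplacian, Fin.sum_univ_two]
  rfl

lemma negLaplacian_mem (u : E) : negLaplacian u ∈ solenoidal := by
  rw [negLaplacian_apply]
  refine solenoidal.neg_mem (solenoidal.add_mem ?_ ?_)
  all_goals
    constructor
    · rw [hasMeanZero_iff]
      intro j
      have h1 : (1 : C(Torus, ℝ)) = ⟨fun _ => 1, isSmooth_one.continuous⟩ := rfl
      rw [h1, pairing_hess u _ j _ isSmooth_one, pairing_apply]
      have h0 : ∀ i, pd i (pd i fun _ => 1) = 0 := by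
        intro i; funext p; simp [pd]
      simp only [ContinuousMap.coe_mk, h0, Pi.zero_apply, mul_zero, integral_zero]
    · rw [isDivFree_iff]
      intro φ h
      have hd := (isDivFree_iff _).1 (H.isDivFree (E.toH u))
      have key : ∀ i, ∑ j : Fin 2, pairing j ⟨_, (h.pd j).continuous⟩ (E.hess i i u) = 0 := by
        intro i
        rw [← hd _ ((h.pd i).pd i)]
        refine Finset.sum_congr rfl fun j _ => ?_
        rw [pairing_hess u i j _ (h.pd j)]
        have hc : pd i (pd i (pd j φ)) = pd j (pd i (pd i φ)) := by
          rw [pd_comm h i j, pd_comm (h.pd i) i j]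
        simp only [hc]
      exact key _

/-- The Stokes operator `A u = -Δ u`, `A : D(A) → H`. -/
def A : E →L[ℝ] H := negLaplacian.codRestrict solenoidal negLaplacian_mem

/-- The vector field `(u · ∇) v = ∑ᵢ uⁱ ∂v/∂xⁱ`, for `u, v ∈ V`. -/
def convection (u v : V) (x : Torus) : Vec :=
  ∑ i : Fin 2, H.toL2 (V.toH u) x i • V.grad v i x

open Classical in
/-- The orthogonal projection of `L²(𝕋²; ℝ²)` onto `H`, applied to a square integrable vector
field. -/
def leray (f : Torus → Vec) : H :=
  if h : MemLp f 2 torusMeasure then H.proj (h.toLp f) else 0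

/-- The bilinear map `B : V × E → H`, `⟨B(u, v), φ⟩ = ∑ᵢⱼ ∫ uⁱ (∂vʲ/∂xⁱ) φʲ dx`. -/
def B (u : V) (v : E) : H := leray (convection u (E.toV v))

/-- The derivative `B'(ū) ω = B(ū, ω) + B(ω, ū)` of `u ↦ B(u, u)` at `ū`. -/
def B' (ubar ω : E) : H := B (E.toV ubar) ω + B (E.toV ω) ubar

/-- `A ū + B(ū) - |∇ū|² ū = 0`. -/
def IsSteadyState (ubar : E) : Prop :=
  A ubar + B (E.toV ubar) ubar - ‖E.grad ubar‖ ^ 2 • E.toH ubar = 0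

/-! ### Spaces of time dependent fields -/

/-- Lebesgue measure on `[0, T]`. -/
abbrev timeMeasure (T : ℝ) : Measure (Icc (0 : ℝ) T) := volume.comap Subtype.val

/-- `L²(0, T; F)`. -/
abbrev L2Time (T : ℝ) (F : Type) [NormedAddCommGroup F] : Type := Lp F 2 (timeMeasure T)

/-- Pairs of a continuous `V`-valued path and an element of `L²(0, T; E)` which agree at almost
every time. -/
def graphX (T : ℝ) : Submodule ℝ (C(Icc (0 : ℝ) T, V) × L2Time T E) where
  carrier := {w | ∀ᵐ t ∂timeMeasure T, E.toV (w.2 t) = w.1 t}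
  add_mem' := by
    intro a b ha hb
    simp only [mem_ofPred_eq] at *
    filter_upwards [ha, hb, Lp.coeFn_add a.2 b.2] with t h1 h2 h3
    change E.toV ((a.2 + b.2 : L2Time T E) t) = a.1 t + b.1 t
    rw [h3, Pi.add_apply, map_add, h1, h2]
  zero_mem' := by
    simp only [mem_ofPred_eq]
    filter_upwards [Lp.coeFn_zero E 2 (timeMeasure T)] with t h
    change E.toV ((0 : L2Time T E) t) = 0
    rw [h, Pi.zero_apply, map_zero]
  smul_mem' := by
    intro c a ha
    simp only [mem_ofPred_eq] at *
    filter_upwards [ha, Lp.coeFn_smul c a.2] with t h1 h2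
    change E.toV ((c • a.2 : L2Time T E) t) = c • a.1 t
    rw [h2, Pi.smul_apply, map_smul, h1]

/-- `X_T = C([0, T]; V) ∩ L²(0, T; E)`: continuous `V`-valued paths, listed together with the
element of `L²(0, T; E)` with which they agree at almost every time. The inherited norm is
`max (sup_t |ω(t)|_V) (∫ |ω(t)|_E² dt)^{1/2}`. -/
def X (T : ℝ) : Type := graphX T

instance (T : ℝ) : NormedAddCommGroup (X T) := inferInstanceAs (NormedAddCommGroup (graphX T))
instance (T : ℝ) : NormedSpace ℝ (X T) := inferInstanceAs (NormedSpace ℝ (graphX T))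

/-- The continuous `V`-valued path of `ω ∈ X_T`. -/
def X.path {T : ℝ} (ω : X T) : C(Icc (0 : ℝ) T, V) := ω.1.1

/-- `ω ∈ X_T` as an element of `L²(0, T; E)`. -/
def X.toE {T : ℝ} (ω : X T) : L2Time T E := ω.1.2

/-- `G(ω) = U - B'(ū) ω + |∇ū|² ω + 2 ⟨∇ū, ∇ω⟩ ū`, at a fixed time. -/
def G (ubar : E) (U : H) (ω : E) : H :=
  U - B' ubar ω + ‖E.grad ubar‖ ^ 2 • E.toH ω
    + (2 * inner ℝ (E.grad ubar) (E.grad ω)) • E.toH ubar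

/-- `w ∈ L²(0, T; H)` is the time derivative `ω_t`: `ω` is absolutely continuous in `H` with
density `w`. -/
def HasTimeDeriv {T : ℝ} (ω : C(Icc (0 : ℝ) T, V)) (w : L2Time T H) : Prop :=
  ∀ s t : Icc (0 : ℝ) T, s ≤ t → V.toH (ω t) - V.toH (ω s) = ∫ r in Ioc s t, w r ∂timeMeasure T

/-- `ω ∈ X_T` solves `ω_t + A ω + B'(ū) ω - |∇ū|² ω - 2 ⟨∇ū, ∇ω⟩ ū = U` on `(0, T)`, with
`ω_t ∈ L²(0, T; H)` and `ω(0) = ω₀`. -/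
def IsLinearizedSolution (ubar : E) {T : ℝ} (hT : 0 < T) (U : L2Time T H) (ω₀ : V) (ω : X T) :
    Prop :=
  ω.path ⟨0, left_mem_Icc.2 hT.le⟩ = ω₀ ∧
    ∃ w : L2Time T H, HasTimeDeriv ω.path w ∧
      ∀ᵐ t ∂timeMeasure T, w t + A (ω.toE t) + B' ubar (ω.toE t) - ‖E.grad ubar‖ ^ 2 • E.toH (ω.toE t)
        - (2 * inner ℝ (E.grad ubar) (E.grad (ω.toE t))) • E.toH ubar = U t

end CNS

end

open CNS MeasureTheory Set

/-!
The Stokes operator `A` is diagonalised by the solenoidal Hartley modes of nonzero frequency, so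
the equation `ω_t + A ω = f` splits into scalar equations `y' = g - l y`. Integrating
`2 l y y' ≤ g² - (l y)²` bounds both `l y²` and the integral of `(l y)²`, and summation over the
modes puts the solution into `X_T`.

The remaining terms of the linearized equation form a bounded operator `E → H`, thanks to the
embedding of `H²` into `L^∞`. Interpolation in frequency shows that this operator is even small
relative to `A + μ` once `μ` is large. The weight `exp (-μ t)` turns `A` into `A + μ` in the energy
inequality, and therefore the map which solves the Stokes equation with given lower order terms is
a contraction of the weighted `L²(0, T; H)`, whatever the length of the time interval. By uniqueness
the solutions on bounded intervals fit together to a solution on `[0, ∞)`.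
-/

noncomputable section

namespace CNS

open UnitAddTorus

/-! ### Hartley functions -/

section Hartley

variable {d : Type*} [Fintype d]

/-- The Haar probability measure on the torus `ℝᵈ / ℤᵈ`; `torusMeasure` is the case `d = Fin 2`. -/
abbrev haarTorus (d : Type*) [Fintype d] : Measure (UnitAddTorus d) :=
  Measure.pi fun _ => AddCircle.haarAddCircle

/-- The Hartley function `cos (2π k·x) + sin (2π k·x)`: a single real function per frequency, in
place of the complex exponential, so that real `L²` has an orthonormal basis indexed by `ℤᵈ`. -/
def cas (k : d → ℤ) : C(UnitAddTorus d, ℝ) where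
  toFun x := (mFourier k x).re + (mFourier k x).im
  continuous_toFun := by fun_prop

lemma cas_apply (k : d → ℤ) (x : UnitAddTorus d) :
    cas k x = (mFourier k x).re + (mFourier k x).im := rfl

lemma cas_neg_apply (k : d → ℤ) (x : UnitAddTorus d) :
    cas (-k) x = (mFourier k x).re - (mFourier k x).im := by
  rw [cas_apply, mFourier_neg, Complex.conj_re, Complex.conj_im, sub_eq_add_neg]

lemma norm_mFourier_apply_le (k : d → ℤ) (x : UnitAddTorus d) : ‖mFourier k x‖ ≤ 1 :=
  ((mFourier k).norm_coe_le_norm x).trans_eq mFourier_norm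

lemma abs_cas_le (k : d → ℤ) (x : UnitAddTorus d) : |cas k x| ≤ 2 := by
  have hre := (Complex.abs_re_le_norm (mFourier k x)).trans (norm_mFourier_apply_le k x)
  have him := (Complex.abs_im_le_norm (mFourier k x)).trans (norm_mFourier_apply_le k x)
  exact (abs_add_le _ _).trans (by linarith)

lemma mFourier_neg_eq_cas (k : d → ℤ) (x : UnitAddTorus d) :
    mFourier (-k) x = (1 - Complex.I) / 2 * cas k x + (1 + Complex.I) / 2 * cas (-k) x := by
  rw [mFourier_neg, cas_neg_apply, cas_apply]
  apply Complex.ext <;> simp <;> ring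

lemma integrable_of_continuous {α F : Type*} [TopologicalSpace α] [CompactSpace α]
    [MeasurableSpace α] [OpensMeasurableSpace α] [NormedAddCommGroup F] {μ : Measure α}
    [IsFiniteMeasureOnCompacts μ] {f : α → F} (hf : Continuous f) : Integrable f μ :=
  hf.integrable_of_hasCompactSupport (HasCompactSupport.of_compactSpace _)

lemma integral_mFourier (k : d → ℤ) :
    ∫ x, mFourier k x ∂haarTorus d = if k = 0 then 1 else 0 := by
  have h := (orthonormal_iff_ite.1 (orthonormal_mFourier (d := d))) 0 k
  rw [ContinuousMap.inner_toLp] at h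
  simpa [mFourier_zero, eq_comm] using! h

lemma cas_mul_cas (k l : d → ℤ) (x : UnitAddTorus d) :
    cas k x * cas l x = (mFourier (k - l) x).re + (mFourier (k + l) x).im := by
  rw [sub_eq_add_neg, mFourier_add, mFourier_add, mFourier_neg]
  simp only [cas_apply, Complex.mul_re, Complex.mul_im, Complex.conj_re, Complex.conj_im]
  ring

lemma integral_cas_mul_cas (k l : d → ℤ) :
    ∫ x, cas k x * cas l x ∂haarTorus d = if k = l then 1 else 0 := by
  have hi (m : d → ℤ) : Integrable (mFourier m) (haarTorus d) :=
    integrable_of_continuous (mFourier m).continuous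
  have hre := integral_re (𝕜 := ℂ) (hi (k - l))
  have him := integral_im (𝕜 := ℂ) (hi (k + l))
  have hadd := integral_add (hi (k - l)).re (hi (k + l)).im
  simp only [RCLike.re_eq_complex_re, RCLike.im_eq_complex_im, integral_mFourier, sub_eq_zero]
    at hre him hadd
  simp only [cas_mul_cas, hadd, hre, him]
  split_ifs <;> simp

lemma mFourierCoeff_ofReal {f : UnitAddTorus d → ℝ} (hf : Integrable f (haarTorus d))
    (k : d → ℤ) : mFourierCoeff (fun x => (f x : ℂ)) k
      = (1 - Complex.I) / 2 * ((∫ x, f x * cas k x ∂haarTorus d : ℝ) : ℂ)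
        + (1 + Complex.I) / 2 * ((∫ x, f x * cas (-k) x ∂haarTorus d : ℝ) : ℂ) := by
  have hi (l : d → ℤ) : Integrable (fun x => ((f x * cas l x : ℝ) : ℂ)) (haarTorus d) :=
    (hf.mul_bdd (c := 2) (cas l).continuous.aestronglyMeasurable
      (ae_of_all _ (abs_cas_le l))).ofReal
  have h : (fun x => mFourier (-k) x • (f x : ℂ))
      = fun x => (1 - Complex.I) / 2 * ((f x * cas k x : ℝ) : ℂ)
        + (1 + Complex.I) / 2 * ((f x * cas (-k) x : ℝ) : ℂ) := by
    funext x
    rw [mFourier_neg_eq_cas]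
    push_cast
    rw [smul_eq_mul]
    ring
  rw [mFourierCoeff, h]
  refine (integral_add ((hi k).const_mul _) ((hi (-k)).const_mul _)).trans ?_
  rw [integral_const_mul, integral_const_mul, integral_complex_ofReal, integral_complex_ofReal]

lemma ae_eq_zero_of_integral_mul_cas {f : UnitAddTorus d → ℝ} (hf : MemLp f 2 (haarTorus d))
    (h : ∀ k, ∫ x, f x * cas k x ∂haarTorus d = 0) : f =ᵐ[haarTorus d] 0 := by
  have hc : MemLp (fun x => (f x : ℂ)) 2 (haarTorus d) := hf.ofReal
  have hz : hc.toLp _ = 0 := by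
    refine (LinearIsometryEquiv.map_eq_zero_iff mFourierBasis.repr).1 ?_
    ext k
    have hk : mFourierCoeff (hc.toLp _) k = mFourierCoeff (fun x => (f x : ℂ)) k :=
      integral_congr_ae (by filter_upwards [hc.coeFn_toLp] with x hx; rw [hx])
    rw [mFourierBasis_repr, hk, mFourierCoeff_ofReal (hf.integrable one_le_two), h, h]
    simp
  filter_upwards [hc.coeFn_toLp, Lp.eq_zero_iff_ae_eq_zero.1 hz] with x hcoe hzero
  exact Complex.ofReal_eq_zero.1 (hcoe.symm.trans hzero)

end Hartley

/-! ### Derivatives of smooth functions -/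

lemma cover_add_single (x : Fin 2 → ℝ) (i : Fin 2) (s : ℝ) :
    cover x + Pi.single i (s : UnitAddCircle) = cover (x + s • Pi.single i 1) := by
  funext j
  by_cases hj : j = i
  · subst hj; simp [cover]
  · simp [cover, hj]

lemma IsSmooth.hasDerivAt_translate {ψ : Torus → ℝ} (h : IsSmooth ψ) (i : Fin 2) (p : Torus)
    (s : ℝ) : HasDerivAt (fun s : ℝ => ψ (p + Pi.single i (s : UnitAddCircle)))
      (CNS.pd i ψ (p + Pi.single i (s : UnitAddCircle))) s := by
  obtain ⟨x, rfl⟩ := cover_surjective p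
  simp only [cover_add_single, pd_cover h]
  have hψ := ((ContDiff.differentiable h (by simp)).differentiableAt
    (x := x + s • Pi.single i 1)).hasFDerivAt
  have hline : HasDerivAt (fun s : ℝ => x + s • (Pi.single i (1 : ℝ) : Fin 2 → ℝ))
      (Pi.single i (1 : ℝ)) s := by
    simpa using ((hasDerivAt_id s).smul_const (Pi.single i (1 : ℝ) : Fin 2 → ℝ)).const_add x
  exact hψ.comp_hasDerivAt s hline

lemma IsSmooth.mul {φ ψ : Torus → ℝ} (h : IsSmooth φ) (h' : IsSmooth ψ) :
    IsSmooth fun x => φ x * ψ x :=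
  ContDiff.mul h h'

lemma pd_mul {φ ψ : Torus → ℝ} (h : IsSmooth φ) (h' : IsSmooth ψ) (i : Fin 2) (x : Torus) :
    pd i (fun x => φ x * ψ x) x = pd i φ x * ψ x + φ x * pd i ψ x := by
  have hd := (h.hasDerivAt_translate i x 0).fun_mul (h'.hasDerivAt_translate i x 0)
  have hx : x + Pi.single i ((0 : ℝ) : UnitAddCircle) = x := by simp
  rw [hx] at hd
  exact hd.deriv

lemma integral_pd {ψ : Torus → ℝ} (h : IsSmooth ψ) (i : Fin 2) :
    ∫ x, pd i ψ x ∂torusMeasure = 0 := by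
  obtain ⟨M, hM⟩ := (isCompact_univ (X := Torus)).exists_bound_of_continuousOn
    (h.pd i).continuous.continuousOn
  have hψ (s : ℝ) : Continuous fun p : Torus => ψ (p + Pi.single i (s : UnitAddCircle)) :=
    h.continuous.comp (by fun_prop)
  have hderiv := (hasDerivAt_integral_of_dominated_loc_of_deriv_le (μ := torusMeasure)
    (F := fun (s : ℝ) (p : Torus) => ψ (p + Pi.single i (s : UnitAddCircle)))
    (F' := fun (s : ℝ) (p : Torus) => pd i ψ (p + Pi.single i (s : UnitAddCircle)))
    (x₀ := 0) (bound := fun _ => M) (s := univ) Filter.univ_mem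
    (.of_forall fun s => (hψ s).aestronglyMeasurable) (integrable_of_continuous (hψ 0))
    ((h.pd i).continuous.comp (by fun_prop)).aestronglyMeasurable
    (ae_of_all _ fun p s _ => hM _ (mem_univ _)) (integrable_const _)
    (ae_of_all _ fun p s _ => h.hasDerivAt_translate i p s)).2
  have htranslate (s : ℝ) : ∫ p, ψ (p + Pi.single i (s : UnitAddCircle)) ∂torusMeasure
      = ∫ p, ψ p ∂torusMeasure := integral_add_right_eq_self ψ _
  simp only [htranslate] at hderiv
  simpa using hderiv.unique (hasDerivAt_const _ _)

lemma integral_mul_pd {φ ψ : Torus → ℝ} (h : IsSmooth φ) (h' : IsSmooth ψ) (i : Fin 2) :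
    ∫ x, φ x * pd i ψ x ∂torusMeasure = - ∫ x, pd i φ x * ψ x ∂torusMeasure := by
  have hprod := integral_pd (h.mul h') i
  simp only [pd_mul h h'] at hprod
  have hadd := integral_add (μ := torusMeasure)
    (integrable_of_continuous ((h.pd i).continuous.mul h'.continuous))
    (integrable_of_continuous (h.continuous.mul (h'.pd i).continuous))
  exact eq_neg_of_add_eq_zero_right (hadd.symm.trans hprod)

/-! ### Hartley coefficients of vector fields -/

/-- Frequencies of Fourier series on the two-dimensional torus. -/
abbrev Freq : Type := Fin 2 → ℤ

lemma mFourier_cover (k : Freq) (x : Fin 2 → ℝ) :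
    mFourier k (cover x) =
      Complex.exp ((2 * Real.pi * (k 0 * x 0 + k 1 * x 1) : ℝ) * Complex.I) := by
  simp only [mFourier, cover, ContinuousMap.coe_mk, Fin.prod_univ_two, fourier_coe_apply,
    ← Complex.exp_add]
  congr 1
  push_cast
  ring

lemma cas_cover (k : Freq) (x : Fin 2 → ℝ) :
    cas k (cover x) = Real.cos (2 * Real.pi * (k 0 * x 0 + k 1 * x 1))
      + Real.sin (2 * Real.pi * (k 0 * x 0 + k 1 * x 1)) := by
  rw [cas_apply, mFourier_cover, Complex.exp_ofReal_mul_I_re, Complex.exp_ofReal_mul_I_im]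

lemma isSmooth_cas (k : Freq) : IsSmooth (cas k) := by
  unfold IsSmooth
  simp only [cas_cover]
  fun_prop

lemma pd_cas (i : Fin 2) (k : Freq) (p : Torus) :
    pd i (cas k) p = 2 * Real.pi * k i * cas (-k) p := by
  obtain ⟨x, rfl⟩ := cover_surjective p
  set a := 2 * Real.pi * (k 0 * x 0 + k 1 * x 1) with ha
  have hline (s : ℝ) : cas k (cover x + Pi.single i (s : UnitAddCircle))
      = Real.cos (a + 2 * Real.pi * k i * s) + Real.sin (a + 2 * Real.pi * k i * s) := by
    rw [cover_add_single, cas_cover, ha]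
    fin_cases i <;> simp <;> ring_nf
  have hphase : HasDerivAt (fun s : ℝ => a + 2 * Real.pi * k i * s) (2 * Real.pi * k i) 0 := by
    simpa using ((hasDerivAt_id (0 : ℝ)).const_mul (2 * Real.pi * k i)).const_add a
  have hderiv : HasDerivAt (fun s : ℝ => Real.cos (a + 2 * Real.pi * k i * s)
      + Real.sin (a + 2 * Real.pi * k i * s)) _ 0 := hphase.cos.add hphase.sin
  simp only [pd, hline, hderiv.deriv, cas_neg_apply, mFourier_cover, Complex.exp_ofReal_mul_I_re,
    Complex.exp_ofReal_mul_I_im, mul_zero, add_zero, ← ha]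
  ring

/-- The vector field `cas_k e_j`. -/
def hartleyField (p : Fin 2 × Freq) : C(Torus, Vec) :=
  ⟨fun x => cas p.2 x • EuclideanSpace.single p.1 (1 : ℝ), by fun_prop⟩

/-- The vector field `cas_k e_j` as an element of `L²`. -/
def hartley (p : Fin 2 × Freq) : L2 :=
  ContinuousMap.toLp (E := Vec) 2 torusMeasure ℝ (hartleyField p)

lemma coeFn_hartley (p : Fin 2 × Freq) : hartley p =ᵐ[torusMeasure] hartleyField p :=
  ContinuousMap.coeFn_toLp (E := Vec) (p := 2) (𝕜 := ℝ) torusMeasure (hartleyField p)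

/-- The Hartley coefficient `∫ uʲ cas_k dx`. -/
abbrev coef (j : Fin 2) (k : Freq) : L2 →L[ℝ] ℝ := pairing j (cas k)

lemma inner_hartley (p : Fin 2 × Freq) (u : L2) : inner ℝ (hartley p) u = coef p.1 p.2 u := rfl

lemma pairing_hartley (i j : Fin 2) (k : Freq) (ψ : C(Torus, ℝ)) :
    pairing i ψ (hartley (j, k)) = if i = j then ∫ x, cas k x * ψ x ∂torusMeasure else 0 := by
  have h : (fun x => hartley (j, k) x i * ψ x) =ᵐ[torusMeasure]
      fun x => (if i = j then 1 else 0) * (cas k x * ψ x) := by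
    filter_upwards [coeFn_hartley (j, k)] with x hx
    simp only [hx, hartleyField, ContinuousMap.coe_mk, PiLp.smul_apply, PiLp.single_apply,
      smul_eq_mul]
    ring
  rw [pairing_apply, integral_congr_ae h, integral_const_mul]
  split_ifs <;> simp

lemma coef_hartley (i j : Fin 2) (k l : Freq) :
    coef i k (hartley (j, l)) = if (i, k) = (j, l) then 1 else 0 := by
  rw [pairing_hartley, integral_cas_mul_cas]
  simp only [Prod.mk.injEq, ite_and, eq_comm (a := l)]

lemma orthonormal_hartley : Orthonormal ℝ hartley :=
  orthonormal_iff_ite.2 fun p q => coef_hartley p.1 q.1 p.2 q.2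

lemma memLp_coord (u : L2) (j : Fin 2) : MemLp (fun x => u x j) 2 torusMeasure :=
  (EuclideanSpace.proj j : Vec →L[ℝ] ℝ).comp_memLp u

lemma eq_zero_of_coef {u : L2} (h : ∀ j k, coef j k u = 0) : u = 0 := by
  have hcoord (j : Fin 2) : (fun x => u x j) =ᵐ[torusMeasure] 0 :=
    ae_eq_zero_of_integral_mul_cas (memLp_coord u j) fun k => by rw [← pairing_apply, h]
  rw [Lp.eq_zero_iff_ae_eq_zero]
  filter_upwards [hcoord 0, hcoord 1] with x h0 h1
  ext j
  fin_cases j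
  · exact h0
  · exact h1

lemma ext_coef {u v : L2} (h : ∀ j k, coef j k u = coef j k v) : u = v :=
  sub_eq_zero.1 (eq_zero_of_coef fun j k => by rw [map_sub, h, sub_self])

/-- The fields `cas_k e_j` as a Hilbert basis of `L²(𝕋²; ℝ²)`. -/
def hartleyBasis : HilbertBasis (Fin 2 × Freq) ℝ L2 :=
  HilbertBasis.mkOfOrthogonalEqBot orthonormal_hartley <|
    (Submodule.eq_bot_iff _).2 fun u hu => eq_zero_of_coef fun j k =>
      (Submodule.mem_orthogonal _ u).1 hu _ (Submodule.subset_span ⟨(j, k), rfl⟩)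

lemma coe_hartleyBasis : ⇑hartleyBasis = hartley := HilbertBasis.coe_mkOfOrthogonalEqBot _ _

lemma hasSum_hartley (u : L2) : HasSum (fun p => coef p.1 p.2 u • hartley p) u := by
  simpa only [HilbertBasis.repr_apply_apply, coe_hartleyBasis, inner_hartley]
    using hartleyBasis.hasSum_repr u

lemma hasSum_inner_coef (u v : L2) :
    HasSum (fun p : Fin 2 × Freq => coef p.1 p.2 u * coef p.1 p.2 v) (inner ℝ u v) := by
  have h := hartleyBasis.hasSum_inner_mul_inner u v
  simp only [coe_hartleyBasis] at h
  exact h.congr_fun fun p => by rw [real_inner_comm (hartley p) u, inner_hartley, inner_hartley]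

lemma hasSum_sq_coef (u : L2) :
    HasSum (fun p : Fin 2 × Freq => coef p.1 p.2 u ^ 2) (‖u‖ ^ 2) := by
  simpa only [sq, real_inner_self_eq_norm_mul_norm] using hasSum_inner_coef u u

lemma norm_le_of_coef {u v : L2} (h : ∀ j k, |coef j k u| ≤ |coef j k v|) : ‖u‖ ≤ ‖v‖ := by
  refine le_of_sq_le_sq ?_ (norm_nonneg _)
  refine hasSum_le (fun p => ?_) (hasSum_sq_coef u) (hasSum_sq_coef v)
  exact sq_le_sq.2 (h p.1 p.2)

lemma hasWeakPartial_hartley (i j : Fin 2) (k : Freq) :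
    HasWeakPartial i (hartley (j, k)) ((2 * Real.pi * k i) • hartley (j, -k)) := by
  rw [hasWeakPartial_iff]
  intro φ h l
  rw [map_smul, pairing_hartley, pairing_hartley]
  split_ifs
  · simp only [ContinuousMap.coe_mk, integral_mul_pd (isSmooth_cas k) h, pd_cas, mul_assoc,
      integral_const_mul, smul_eq_mul]
    ring
  · simp

lemma HasWeakPartial.coef_eq {i : Fin 2} {u g : L2} (h : HasWeakPartial i u g) (j : Fin 2)
    (k : Freq) : coef j k g = -(2 * Real.pi * k i) * coef j (-k) u := by
  have hweak := h (cas k) (isSmooth_cas k) j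
  simp only [pd_cas, mul_left_comm _ (2 * Real.pi * k i), integral_const_mul, ← pairing_apply]
    at hweak
  linarith

/-! ### The Stokes operator in Hartley coefficients -/

lemma coef_grad (u : V) (i j : Fin 2) (k : Freq) :
    coef j k (V.grad u i) = -(2 * Real.pi * k i) * coef j (-k) (H.toL2 (V.toH u)) :=
  (V.weak u i).coef_eq j k

lemma coef_hess (u : E) (i j l : Fin 2) (k : Freq) :
    coef l k (E.hess i j u) = -(4 * Real.pi ^ 2 * (k i * k j)) * coef l k (H.toL2 (E.toH u)) := by
  have hgrad : coef l (-k) (E.grad u j) = 2 * Real.pi * k j * coef l k (H.toL2 (E.toH u)) := by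
    simpa using! coef_grad (E.toV u) j l (-k)
  rw [(E.weak u i j).coef_eq l k, hgrad]
  ring

/-- The eigenvalue `4π²|k|²` of the Stokes operator at frequency `k`. -/
def eigenvalue (k : Freq) : ℝ := 4 * Real.pi ^ 2 * ((k 0 : ℝ) ^ 2 + (k 1 : ℝ) ^ 2)

lemma eigenvalue_nonneg (k : Freq) : 0 ≤ eigenvalue k := by unfold eigenvalue; positivity

lemma one_le_sq_add_sq {k : Freq} (hk : k ≠ 0) : (1 : ℝ) ≤ (k 0 : ℝ) ^ 2 + (k 1 : ℝ) ^ 2 := by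
  have hint : (1 : ℤ) ≤ k 0 ^ 2 + k 1 ^ 2 := by
    by_contra hlt
    have h0 : k 0 = 0 := by nlinarith [sq_nonneg (k 0), sq_nonneg (k 1)]
    have h1 : k 1 = 0 := by nlinarith [sq_nonneg (k 0), sq_nonneg (k 1)]
    exact hk (by ext i; fin_cases i <;> simp [h0, h1])
  exact_mod_cast hint

lemma sq_add_sq_le_eigenvalue (k : Freq) : (k 0 : ℝ) ^ 2 + (k 1 : ℝ) ^ 2 ≤ eigenvalue k :=
  le_mul_of_one_le_left (by positivity) (by nlinarith [Real.pi_gt_three])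

lemma one_le_eigenvalue {k : Freq} (hk : k ≠ 0) : 1 ≤ eigenvalue k :=
  (one_le_sq_add_sq hk).trans (sq_add_sq_le_eigenvalue k)

lemma abs_mul_le_sq_add_sq (k : Freq) (i j : Fin 2) :
    |(k i * k j : ℝ)| ≤ (k 0 : ℝ) ^ 2 + (k 1 : ℝ) ^ 2 := by
  rw [abs_le]
  fin_cases i <;> fin_cases j <;> constructor <;> simp <;>
    nlinarith [sq_nonneg ((k 0 : ℝ) + k 1), sq_nonneg ((k 0 : ℝ) - k 1)]

lemma coef_A (u : E) (l : Fin 2) (k : Freq) :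
    coef l k (H.toL2 (A u)) = eigenvalue k * coef l k (H.toL2 (E.toH u)) := by
  have hA : H.toL2 (A u) = -(E.hess 0 0 u + E.hess 1 1 u) := negLaplacian_apply u
  rw [hA, map_neg, map_add, coef_hess, coef_hess, eigenvalue]
  ring

lemma cas_zero : (cas 0 : C(Torus, ℝ)) = 1 := by
  ext x
  simp [cas_apply, UnitAddTorus.mFourier_zero]

lemma hasMeanZero_iff_coef (u : L2) : HasMeanZero u ↔ ∀ j, coef j 0 u = 0 := by
  rw [hasMeanZero_iff, ← cas_zero]

lemma coef_zero_freq (u : H) (j : Fin 2) : coef j 0 (H.toL2 u) = 0 :=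
  (hasMeanZero_iff_coef _).1 u.2.1 j

lemma coef_divFree (u : H) (k : Freq) :
    k 0 * coef 0 k (H.toL2 u) + k 1 * coef 1 k (H.toL2 u) = 0 := by
  have hdiv := H.isDivFree u (cas (-k)) (isSmooth_cas _)
  simp only [pd_cas, neg_neg, Pi.neg_apply, Int.cast_neg, mul_left_comm _ (2 * Real.pi * -_),
    integral_const_mul, ← pairing_apply, Fin.sum_univ_two] at hdiv
  refine (mul_eq_zero.1 ?_).resolve_left (neg_ne_zero.2 Real.two_pi_pos.ne')
  linear_combination hdiv

/-! ### Norms -/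

lemma H.norm_toL2 (u : H) : ‖H.toL2 u‖ = ‖u‖ := rfl

lemma H.inner_toL2 (u v : H) : inner ℝ (H.toL2 u) (H.toL2 v) = inner ℝ u v := rfl

lemma H.toL2_injective : Function.Injective H.toL2 := Subtype.val_injective

lemma V.norm_sq (u : V) : ‖u‖ ^ 2 = ‖V.toH u‖ ^ 2 + ‖V.grad u‖ ^ 2 :=
  WithLp.prod_norm_sq_eq_of_L2 _

lemma E.norm_sq (u : E) :
    ‖u‖ ^ 2 = ‖E.toV u‖ ^ 2 + ∑ p : Fin 2 × Fin 2, ‖E.hess p.1 p.2 u‖ ^ 2 := by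
  have hprod : ‖u‖ ^ 2 = ‖E.toV u‖ ^ 2 + ‖(WithLp.sndL 2 ℝ V Hessians) (graphE.subtypeL u)‖ ^ 2 :=
    WithLp.prod_norm_sq_eq_of_L2 _
  rw [hprod, PiLp.norm_sq_eq_of_L2]
  rfl

lemma V.toH_injective : Function.Injective V.toH := by
  rw [injective_iff_map_eq_zero]
  intro u hu
  have hgrad : V.grad u = 0 := by
    ext i : 1
    refine eq_zero_of_coef fun j k => ?_
    rw [coef_grad, hu, map_zero, map_zero, mul_zero]
  have hnorm := V.norm_sq u
  rw [hu, hgrad] at hnorm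
  simpa using hnorm

lemma hasSum_neg_freq {f : Fin 2 × Freq → ℝ} {a : ℝ} (h : HasSum f a) :
    HasSum (fun p : Fin 2 × Freq => f (p.1, -p.2)) a :=
  ((Equiv.refl (Fin 2)).prodCongr (Equiv.neg Freq)).hasSum_iff.2 h

lemma hasSum_sq_grad (u : V) :
    HasSum (fun p : Fin 2 × Freq => eigenvalue p.2 * coef p.1 p.2 (H.toL2 (V.toH u)) ^ 2)
      (‖V.grad u‖ ^ 2) := by
  rw [PiLp.norm_sq_eq_of_L2]
  have h := hasSum_sum (s := Finset.univ) fun i (_ : i ∈ (Finset.univ : Finset (Fin 2))) =>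
    hasSum_neg_freq (hasSum_sq_coef (V.grad u i))
  refine h.congr_fun fun p => ?_
  simp only [coef_grad, neg_neg, Fin.sum_univ_two, eigenvalue, Pi.neg_apply, Int.cast_neg]
  ring

lemma norm_grad_sq (u : E) : ‖E.grad u‖ ^ 2 = inner ℝ (A u) (E.toH u) := by
  refine (hasSum_sq_grad (E.toV u)).unique ?_
  rw [← H.inner_toL2]
  refine (hasSum_inner_coef _ _).congr_fun fun p => ?_
  rw [coef_A]
  change _ * coef p.1 p.2 (H.toL2 (E.toH u)) ^ 2 = _
  ring

/-- The shifted Stokes operator `A + μ`. -/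
def shiftedA (μ : ℝ) : E →L[ℝ] H := A + μ • E.toH

lemma shiftedA_apply (μ : ℝ) (u : E) : shiftedA μ u = A u + μ • E.toH u := rfl

lemma coef_shiftedA (μ : ℝ) (u : E) (l : Fin 2) (k : Freq) :
    coef l k (H.toL2 (shiftedA μ u)) = (eigenvalue k + μ) * coef l k (H.toL2 (E.toH u)) := by
  rw [shiftedA_apply, map_add, map_smul, map_add, map_smul, coef_A, smul_eq_mul]
  ring

lemma norm_A_le_norm_shiftedA {μ : ℝ} (hμ : 0 ≤ μ) (u : E) : ‖A u‖ ≤ ‖shiftedA μ u‖ := by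
  rw [← H.norm_toL2, ← H.norm_toL2]
  refine norm_le_of_coef fun j k => ?_
  rw [coef_A, coef_shiftedA, abs_mul, abs_mul]
  have := eigenvalue_nonneg k
  gcongr
  linarith

lemma mul_norm_toH_le_norm_shiftedA {μ : ℝ} (hμ : 0 ≤ μ) (u : E) :
    μ * ‖E.toH u‖ ≤ ‖shiftedA μ u‖ := by
  rw [← Real.norm_of_nonneg hμ, ← norm_smul, ← H.norm_toL2, ← H.norm_toL2, map_smul,
    Real.norm_of_nonneg hμ]
  refine norm_le_of_coef fun j k => ?_
  rw [map_smul, coef_shiftedA, smul_eq_mul, abs_mul, abs_mul]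
  have := eigenvalue_nonneg k
  gcongr
  linarith

lemma norm_toH_le_norm_A (u : E) : ‖E.toH u‖ ≤ ‖A u‖ := by
  rw [← H.norm_toL2, ← H.norm_toL2]
  refine norm_le_of_coef fun j k => ?_
  rcases eq_or_ne k 0 with rfl | hk
  · rw [coef_zero_freq, coef_zero_freq]
  · rw [coef_A, abs_mul, abs_of_nonneg (eigenvalue_nonneg k)]
    exact le_mul_of_one_le_left (abs_nonneg _) (one_le_eigenvalue hk)

lemma norm_hess_le_norm_A (u : E) (i j : Fin 2) : ‖E.hess i j u‖ ≤ ‖A u‖ := by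
  rw [← H.norm_toL2]
  refine norm_le_of_coef fun l k => ?_
  rw [coef_A, coef_hess, abs_mul, abs_mul, abs_neg, abs_mul, abs_of_nonneg (eigenvalue_nonneg k),
    eigenvalue, abs_of_nonneg (a := 4 * Real.pi ^ 2) (by positivity)]
  gcongr
  exact abs_mul_le_sq_add_sq k i j

lemma mul_norm_grad_sq_le {μ : ℝ} (hμ : 0 ≤ μ) (u : E) :
    μ * ‖E.grad u‖ ^ 2 ≤ ‖shiftedA μ u‖ ^ 2 := by
  calc μ * ‖E.grad u‖ ^ 2 ≤ μ * (‖A u‖ * ‖E.toH u‖) := by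
        rw [norm_grad_sq]; gcongr; exact real_inner_le_norm _ _
    _ = ‖A u‖ * (μ * ‖E.toH u‖) := by ring
    _ ≤ ‖shiftedA μ u‖ * ‖shiftedA μ u‖ := by
        gcongr
        exacts [norm_A_le_norm_shiftedA hμ u, mul_norm_toH_le_norm_shiftedA hμ u]
    _ = _ := (sq _).symm

lemma norm_toV_sq (u : E) : ‖E.toV u‖ ^ 2 = ‖E.toH u‖ ^ 2 + inner ℝ (A u) (E.toH u) := by
  rw [← norm_grad_sq]
  exact V.norm_sq _

lemma norm_le_norm_A (u : E) : ‖u‖ ≤ 3 * ‖A u‖ := by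
  refine le_of_sq_le_sq ?_ (by positivity)
  have hinner : inner ℝ (A u) (E.toH u) ≤ ‖A u‖ * ‖A u‖ :=
    (real_inner_le_norm _ _).trans (by gcongr; exact norm_toH_le_norm_A u)
  have htoH : ‖E.toH u‖ ^ 2 ≤ ‖A u‖ ^ 2 := by gcongr; exact norm_toH_le_norm_A u
  have hhess : ∑ p : Fin 2 × Fin 2, ‖E.hess p.1 p.2 u‖ ^ 2 ≤ ∑ _p : Fin 2 × Fin 2, ‖A u‖ ^ 2 := by
    gcongr; exact norm_hess_le_norm_A u _ _
  norm_num [Finset.card_univ] at hhess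
  rw [E.norm_sq, norm_toV_sq]
  linarith [sq_nonneg ‖A u‖]

/-! ### Completeness of `V` and `E` -/

lemma isClosed_hasWeakPartial (i : Fin 2) :
    IsClosed {p : L2 × L2 | HasWeakPartial i p.1 p.2} := by
  simp only [hasWeakPartial_iff, ofPred_forall]
  exact isClosed_iInter fun φ => isClosed_iInter fun h => isClosed_iInter fun j =>
    isClosed_eq (by fun_prop) continuous_const

lemma isClosed_graphV : IsClosed (graphV : Set (WithLp 2 (H × Grads))) := by
  have hcont (i : Fin 2) : Continuous fun w : WithLp 2 (H × Grads) => (H.toL2 w.fst, w.snd i) := by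
    fun_prop
  change IsClosed {w : WithLp 2 (H × Grads) | ∀ i, HasWeakPartial i (H.toL2 w.fst) (w.snd i)}
  simp only [ofPred_forall]
  exact isClosed_iInter fun i => (isClosed_hasWeakPartial i).preimage (hcont i)

instance : CompleteSpace V := isClosed_graphV.completeSpace_coe

lemma isClosed_graphE : IsClosed (graphE : Set (WithLp 2 (V × Hessians))) := by
  have hcont (i j : Fin 2) :
      Continuous fun w : WithLp 2 (V × Hessians) => (V.grad w.fst j, w.snd (i, j)) := by
    fun_prop
  change IsClosed {w : WithLp 2 (V × Hessians) |
    ∀ i j, HasWeakPartial i (V.grad w.fst j) (w.snd (i, j))}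
  simp only [ofPred_forall]
  exact isClosed_iInter fun i => isClosed_iInter fun j =>
    (isClosed_hasWeakPartial i).preimage (hcont i j)

instance : CompleteSpace E := isClosed_graphE.completeSpace_coe

/-! ### Eigenfunctions of the Stokes operator -/

/-- Nonzero frequencies. -/
abbrev NZFreq : Type := {k : Freq // k ≠ 0}

/-- The unit vector `k^⊥ / |k|`, the polarization of the solenoidal modes of frequency `k`. -/
def perp (k : Freq) : Fin 2 → ℝ :=
  (Real.sqrt ((k 0 : ℝ) ^ 2 + (k 1 : ℝ) ^ 2))⁻¹ • ![-(k 1 : ℝ), k 0]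

lemma mul_perp (k : Freq) : k 0 * perp k 0 + k 1 * perp k 1 = 0 := by
  simp only [perp, Pi.smul_apply, Matrix.cons_val_zero, Matrix.cons_val_one, smul_eq_mul]
  ring

lemma perp_sq {k : Freq} (hk : k ≠ 0) : perp k 0 ^ 2 + perp k 1 ^ 2 = 1 := by
  have h := one_le_sq_add_sq hk
  simp only [perp, Pi.smul_apply, Matrix.cons_val_zero, Matrix.cons_val_one, smul_eq_mul, mul_pow,
    inv_pow, Real.sq_sqrt (zero_le_one.trans h)]
  field_simp
  ring

/-- The plane wave `cas_l d` with constant vector `d`. -/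
def plane (d : Fin 2 → ℝ) (l : Freq) : L2 := d 0 • hartley (0, l) + d 1 • hartley (1, l)

lemma hasWeakPartial_plane (d : Fin 2 → ℝ) (l : Freq) (i : Fin 2) :
    HasWeakPartial i (plane d l) ((2 * Real.pi * l i) • plane d (-l)) := by
  have h :=
    ((hasWeakPartial_hartley i 0 l).smul (d 0)).add ((hasWeakPartial_hartley i 1 l).smul (d 1))
  simpa only [plane, smul_add, smul_comm (2 * Real.pi * (l i : ℝ))] using h

lemma coef_plane (d : Fin 2 → ℝ) (k l : Freq) (j : Fin 2) :
    coef j k (plane d l) = if k = l then d j else 0 := by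
  rw [plane, map_add, map_smul, map_smul, coef_hartley, coef_hartley]
  fin_cases j <;> simp

lemma isDivFree_plane {d : Fin 2 → ℝ} {l : Freq} (h : l 0 * d 0 + l 1 * d 1 = 0) :
    IsDivFree (plane d l) := by
  rw [isDivFree_iff]
  intro φ hφ
  simp only [Fin.sum_univ_two, plane, map_add, map_smul, pairing_hartley, ContinuousMap.coe_mk,
    integral_mul_pd (isSmooth_cas l) hφ, pd_cas, mul_assoc, integral_const_mul, if_true,
    one_ne_zero, zero_ne_one, if_false, smul_eq_mul]
  linear_combination (-(2 * Real.pi) * ∫ x, cas (-l) x * φ x ∂torusMeasure) * h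

lemma plane_perp_mem (k : NZFreq) : plane (perp k) k ∈ solenoidal := by
  refine ⟨(hasMeanZero_iff_coef _).2 fun j => ?_, isDivFree_plane (mul_perp k)⟩
  rw [coef_plane, if_neg (Ne.symm k.2)]

/-- The normalized eigenfunction of the Stokes operator of frequency `k`, in `H`. -/
def eigenH (k : NZFreq) : H := ⟨plane (perp k) k, plane_perp_mem k⟩

/-- The normalized eigenfunction of the Stokes operator of frequency `k`, in `V`. -/
def eigenV (k : NZFreq) : V :=
  ⟨WithLp.toLp 2 (eigenH k, WithLp.toLp 2 fun i => (2 * Real.pi * k.1 i) • plane (perp k) (-k)),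
    fun i => hasWeakPartial_plane _ _ i⟩

/-- The normalized eigenfunction of the Stokes operator of frequency `k`, in `E`. -/
def eigenE (k : NZFreq) : E :=
  ⟨WithLp.toLp 2 (eigenV k, WithLp.toLp 2 fun p =>
    (2 * Real.pi * k.1 p.2) • (2 * Real.pi * (-k.1) p.1) • plane (perp k) k), fun i j => by
      have h := (hasWeakPartial_plane (perp k) (-k) i).smul (2 * Real.pi * k.1 j)
      rw [neg_neg] at h
      exact h⟩

lemma toL2_eigenH (k : NZFreq) : H.toL2 (eigenH k) = plane (perp k) k := rfl

lemma toH_eigenE (k : NZFreq) : E.toH (eigenE k) = eigenH k := rfl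

lemma A_eigenE (k : NZFreq) : A (eigenE k) = eigenvalue k • eigenH k := by
  refine H.toL2_injective (ext_coef fun j l => ?_)
  rw [coef_A, map_smul, map_smul, toH_eigenE, toL2_eigenH, coef_plane, smul_eq_mul]
  split_ifs with h
  · rw [h]
  · simp

lemma inner_eigenH (k : NZFreq) (u : H) : inner ℝ (eigenH k) u
    = perp k 0 * coef 0 k (H.toL2 u) + perp k 1 * coef 1 k (H.toL2 u) := by
  rw [← H.inner_toL2, toL2_eigenH, plane, inner_add_left, real_inner_smul_left,
    real_inner_smul_left, inner_hartley, inner_hartley]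

-- Solenoidality makes the coefficient vector parallel to `perp k`, so no information is lost.
lemma inner_eigenH_sq (k : NZFreq) (u : H) : inner ℝ (eigenH k) u ^ 2
    = coef 0 k (H.toL2 u) ^ 2 + coef 1 k (H.toL2 u) ^ 2 := by
  have hdiv := coef_divFree u k
  have hk := one_le_sq_add_sq k.2
  rw [inner_eigenH]
  simp only [perp, Pi.smul_apply, Matrix.cons_val_zero, Matrix.cons_val_one, smul_eq_mul,
    mul_assoc, ← mul_add, mul_pow, inv_pow, Real.sq_sqrt (zero_le_one.trans hk)]
  rw [inv_mul_eq_iff_eq_mul₀ (by positivity)]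
  linear_combination
    (-(k.1 0 * coef 0 k (H.toL2 u) + k.1 1 * coef 1 k (H.toL2 u))) * hdiv

lemma orthonormal_eigenH : Orthonormal ℝ eigenH := by
  rw [orthonormal_iff_ite]
  intro k l
  rw [inner_eigenH, toL2_eigenH, coef_plane, coef_plane]
  rcases eq_or_ne k l with rfl | h
  · simp only [if_true, ← sq, perp_sq k.2]
  · simp [h, Subtype.coe_injective.ne h]

lemma eq_zero_of_inner_eigenH {u : H} (h : ∀ k, inner ℝ (eigenH k) u = 0) : u = 0 := by
  refine H.toL2_injective (ext_coef fun j k => ?_)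
  rw [map_zero, map_zero]
  rcases eq_or_ne k 0 with rfl | hk
  · exact coef_zero_freq u j
  · have hsq := inner_eigenH_sq ⟨k, hk⟩ u
    rw [h, zero_pow two_ne_zero, eq_comm,
      add_eq_zero_iff_of_nonneg (sq_nonneg _) (sq_nonneg _), sq_eq_zero_iff, sq_eq_zero_iff] at hsq
    fin_cases j
    exacts [hsq.1, hsq.2]

/-- The Hilbert basis of `H` of eigenfunctions of the Stokes operator. -/
def stokesBasis : HilbertBasis NZFreq ℝ H :=
  HilbertBasis.mkOfOrthogonalEqBot orthonormal_eigenH <|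
    (Submodule.eq_bot_iff _).2 fun u hu => eq_zero_of_inner_eigenH fun k =>
      (Submodule.mem_orthogonal _ u).1 hu _ (Submodule.subset_span ⟨k, rfl⟩)

lemma coe_stokesBasis : ⇑stokesBasis = eigenH := HilbertBasis.coe_mkOfOrthogonalEqBot _ _

lemma hasSum_sq_inner_eigenH (u : H) :
    HasSum (fun k => inner ℝ (eigenH k) u ^ 2) (‖u‖ ^ 2) := by
  have h := stokesBasis.hasSum_inner_mul_inner u u
  simp only [coe_stokesBasis, real_inner_self_eq_norm_sq] at h
  exact h.congr_fun fun k => by rw [real_inner_comm (eigenH k) u, sq]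

lemma ext_inner_eigenH {u v : H} (h : ∀ k, inner ℝ (eigenH k) u = inner ℝ (eigenH k) v) :
    u = v :=
  sub_eq_zero.1 (eq_zero_of_inner_eigenH fun k => by rw [inner_sub_right, h, sub_self])

lemma inner_eigenH_A (k : NZFreq) (u : E) :
    inner ℝ (eigenH k) (A u) = eigenvalue k * inner ℝ (eigenH k) (E.toH u) := by
  rw [inner_eigenH, inner_eigenH, coef_A, coef_A]
  ring

lemma inner_eigenH_shiftedA (μ : ℝ) (k : NZFreq) (u : E) :
    inner ℝ (eigenH k) (shiftedA μ u) = (eigenvalue k + μ) * inner ℝ (eigenH k) (E.toH u) := by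
  rw [shiftedA_apply, inner_add_right, inner_smul_right, inner_eigenH_A]
  ring

lemma summable_eigenvalue_mul_sq (u : V) :
    Summable fun k : NZFreq => eigenvalue k * inner ℝ (eigenH k) (V.toH u) ^ 2 := by
  have hj (j : Fin 2) : Summable fun k : NZFreq =>
      eigenvalue k * coef j k (H.toL2 (V.toH u)) ^ 2 :=
    (hasSum_sq_grad u).summable.comp_injective
      (i := fun k : NZFreq => ((j, (k : Freq)) : Fin 2 × Freq)) fun a b hab =>
      Subtype.ext (congrArg Prod.snd hab)
  refine ((hj 0).add (hj 1)).congr fun k => ?_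
  rw [inner_eigenH_sq, mul_add]

/-! ### The embedding of `E` into bounded fields -/

lemma summable_mul_and_tsum_mul_le {ι : Type*} {f g : ι → ℝ} {a b : ℝ} (ha : 0 ≤ a) (hb : 0 ≤ b)
    (hf : ∀ i, 0 ≤ f i) (hg : ∀ i, 0 ≤ g i) (hfa : HasSum (fun i => f i ^ 2) (a ^ 2))
    (hgb : HasSum (fun i => g i ^ 2) (b ^ 2)) :
    Summable (fun i => f i * g i) ∧ ∑' i, f i * g i ≤ a * b := by
  simp only [← Real.rpow_two] at hfa hgb
  obtain ⟨c, -, hc, hsum⟩ :=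
    Real.inner_le_Lp_mul_Lq_hasSum_of_nonneg Real.HolderConjugate.two_two ha hb hf hg hfa hgb
  exact ⟨hsum.summable, hsum.tsum_eq.trans_le hc⟩

lemma norm_sq_le_eigenvalue (k : Freq) : ‖k‖ ^ 2 ≤ eigenvalue k := by
  obtain ⟨i, hi⟩ : ∃ i, ‖k i‖ = ‖k‖ := (Finite.exists_max fun i => ‖k i‖).imp fun i hi =>
    (norm_le_pi_norm k i).antisymm ((pi_norm_le_iff_of_nonneg (norm_nonneg _)).2 hi)
  refine le_trans ?_ (sq_add_sq_le_eigenvalue k)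
  rw [← hi, Int.norm_eq_abs, sq_abs, ← Fin.sum_univ_two fun i => (k i : ℝ) ^ 2]
  exact Finset.single_le_sum (f := fun i => (k i : ℝ) ^ 2) (fun _ _ => sq_nonneg _)
    (Finset.mem_univ i)

lemma summable_inv_norm_pow_three : Summable fun p : Fin 2 × Freq => (‖p.2‖ ^ 3)⁻¹ := by
  have hfreq : Summable fun k : Freq => (‖k‖ ^ 3)⁻¹ := by
    refine (EisensteinSeries.summable_one_div_norm_rpow (k := 3) (by norm_num)).congr fun k => ?_
    rw [Real.rpow_neg (norm_nonneg k)]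
    norm_cast
  have hprod := (Summable.of_finite (f := fun _ : Fin 2 => (1 : ℝ))).mul_of_nonneg hfreq
    (fun _ => zero_le_one) (fun _ => by positivity)
  simpa using hprod

/-- The lattice sum `∑ |k|⁻³` over the frequencies of both components; it controls the sum of the
coefficients of a field by its `H²` norm. The term of `k = 0` is `0⁻¹ = 0`. -/
def latticeSum : ℝ := ∑' p : Fin 2 × Freq, (‖p.2‖ ^ 3)⁻¹

lemma latticeSum_nonneg : 0 ≤ latticeSum := tsum_nonneg fun _ => by positivity

lemma pow_three_mul_le {x m : ℝ} (hx : 0 ≤ x) (hm : 0 ≤ m) : x ^ 3 * m ≤ (x ^ 2 + m ^ 2) ^ 2 := by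
  nlinarith [mul_nonneg (sq_nonneg x) (sq_nonneg (x - m)), mul_nonneg (pow_nonneg hx 3) hm,
    sq_nonneg (x * m), sq_nonneg (m ^ 2), sq_nonneg (x ^ 2)]

lemma abs_coef_le {m : ℝ} (hm : 0 < m) (u : E) (p : Fin 2 × Freq) :
    |coef p.1 p.2 (H.toL2 (E.toH u))|
      ≤ Real.sqrt ((‖p.2‖ ^ 3)⁻¹ / m) * |coef p.1 p.2 (H.toL2 (shiftedA (m ^ 2) u))| := by
  obtain ⟨j, k⟩ := p
  rcases eq_or_ne k 0 with rfl | hk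
  · simp [coef_zero_freq]
  have hn : 0 < ‖k‖ := norm_pos_iff.2 hk
  have hpos : 0 < eigenvalue k + m ^ 2 := by positivity [eigenvalue_nonneg k]
  rw [coef_shiftedA, abs_mul, ← mul_assoc, abs_of_pos hpos]
  refine le_mul_of_one_le_left (abs_nonneg _) ?_
  rw [← div_le_iff₀ hpos]
  apply Real.le_sqrt_of_sq_le
  rw [div_pow, one_pow, ← one_div, div_div]
  refine one_div_le_one_div_of_le (by positivity) ((pow_three_mul_le hn.le hm.le).trans ?_)
  gcongr
  exact norm_sq_le_eigenvalue k

lemma summable_abs_coef {m : ℝ} (hm : 0 < m) (u : E) :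
    Summable (fun p : Fin 2 × Freq => |coef p.1 p.2 (H.toL2 (E.toH u))|) ∧
    ∑' p : Fin 2 × Freq, |coef p.1 p.2 (H.toL2 (E.toH u))|
      ≤ Real.sqrt (latticeSum / m) * ‖shiftedA (m ^ 2) u‖ := by
  have hweight : HasSum (fun p : Fin 2 × Freq => Real.sqrt ((‖p.2‖ ^ 3)⁻¹ / m) ^ 2)
      (Real.sqrt (latticeSum / m) ^ 2) := by
    rw [Real.sq_sqrt (div_nonneg latticeSum_nonneg hm.le)]
    exact (summable_inv_norm_pow_three.hasSum.div_const m).congr_fun fun p =>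
      Real.sq_sqrt (by positivity)
  have hcoef : HasSum (fun p : Fin 2 × Freq => |coef p.1 p.2 (H.toL2 (shiftedA (m ^ 2) u))| ^ 2)
      (‖shiftedA (m ^ 2) u‖ ^ 2) := by
    simp only [sq_abs, ← H.norm_toL2]
    exact hasSum_sq_coef _
  obtain ⟨hsum, hle⟩ := summable_mul_and_tsum_mul_le (Real.sqrt_nonneg _) (norm_nonneg _)
    (fun _ => Real.sqrt_nonneg _) (fun _ => abs_nonneg _) hweight hcoef
  have hs := Summable.of_nonneg_of_le (fun _ => abs_nonneg _) (abs_coef_le hm u) hsum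
  exact ⟨hs, (hs.tsum_le_tsum (abs_coef_le hm u) hsum).trans hle⟩

lemma norm_hartleyField_le (p : Fin 2 × Freq) : ‖hartleyField p‖ ≤ 2 := by
  rw [ContinuousMap.norm_le _ zero_le_two]
  intro x
  simp only [hartleyField, ContinuousMap.coe_mk, norm_smul, PiLp.norm_single, norm_one, mul_one]
  exact abs_cas_le _ x

-- The free parameter `m` makes the bound small relative to `A + m²`.
lemma ae_norm_le {m : ℝ} (hm : 0 < m) (u : E) : ∀ᵐ x ∂torusMeasure,
    ‖H.toL2 (E.toH u) x‖ ≤ 2 * Real.sqrt (latticeSum / m) * ‖shiftedA (m ^ 2) u‖ := by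
  obtain ⟨hsum, hle⟩ := summable_abs_coef hm u
  have hterm (p : Fin 2 × Freq) : ‖coef p.1 p.2 (H.toL2 (E.toH u)) • hartleyField p‖
      ≤ 2 * |coef p.1 p.2 (H.toL2 (E.toH u))| := by
    rw [norm_smul, Real.norm_eq_abs, mul_comm]
    gcongr
    exact norm_hartleyField_le p
  have hseries := (Summable.of_norm_bounded (hsum.mul_left 2) hterm).hasSum
  have hnorm : ‖∑' p : Fin 2 × Freq, coef p.1 p.2 (H.toL2 (E.toH u)) • hartleyField p‖
      ≤ 2 * Real.sqrt (latticeSum / m) * ‖shiftedA (m ^ 2) u‖ := by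
    refine (tsum_of_norm_bounded (hsum.mul_left 2).hasSum hterm).trans ?_
    rw [tsum_mul_left, mul_assoc]
    gcongr
  have hL2 := hseries.mapL (ContinuousMap.toLp (E := Vec) 2 torusMeasure ℝ)
  simp only [map_smul] at hL2
  rw [(hasSum_hartley (H.toL2 (E.toH u))).unique hL2]
  filter_upwards [ContinuousMap.coeFn_toLp (E := Vec) (p := 2) (𝕜 := ℝ) torusMeasure
    (∑' p : Fin 2 × Freq, coef p.1 p.2 (H.toL2 (E.toH u)) • hartleyField p)] with x hx
  rw [hx]
  exact (ContinuousMap.norm_coe_le_norm _ x).trans hnorm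

lemma memLp_top_toL2 (u : E) : MemLp (H.toL2 (E.toH u)) ⊤ torusMeasure :=
  memLp_top_of_bound (Lp.aestronglyMeasurable _) _ (ae_norm_le one_pos u)

lemma norm_toLp_toL2_le {m : ℝ} (hm : 0 < m) (u : E) : ‖(memLp_top_toL2 u).toLp _‖
    ≤ 2 * Real.sqrt (latticeSum / m) * ‖shiftedA (m ^ 2) u‖ := by
  have hbound : ∀ᵐ x ∂torusMeasure, ‖(memLp_top_toL2 u).toLp _ x‖
      ≤ 2 * Real.sqrt (latticeSum / m) * ‖shiftedA (m ^ 2) u‖ := by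
    filter_upwards [(memLp_top_toL2 u).coeFn_toLp, ae_norm_le hm u] with x hx hle
    rwa [hx]
  simpa using Lp.norm_le_of_ae_bound (by positivity) hbound

/-- The Sobolev embedding `H² ⊂ L^∞` on `E`. -/
def E.toLinfty : E →L[ℝ] Lp Vec ⊤ torusMeasure :=
  LinearMap.mkContinuous
    { toFun u := (memLp_top_toL2 u).toLp _
      map_add' u v := by
        rw [← MemLp.toLp_add]
        refine MemLp.toLp_congr _ _ ?_
        rw [map_add, map_add]
        exact Lp.coeFn_add _ _
      map_smul' c u := by
        rw [← MemLp.toLp_const_smul]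
        refine MemLp.toLp_congr _ _ ?_
        rw [map_smul, map_smul]
        exact Lp.coeFn_smul _ _ }
    (2 * Real.sqrt (latticeSum / 1) * ‖shiftedA (1 ^ 2)‖) fun u =>
      (norm_toLp_toL2_le one_pos u).trans (by
        rw [mul_assoc _ ‖shiftedA (1 ^ 2)‖]; gcongr; exact (shiftedA _).le_opNorm u)

lemma coeFn_toLinfty (u : E) : E.toLinfty u =ᵐ[torusMeasure] H.toL2 (E.toH u) :=
  (memLp_top_toL2 u).coeFn_toLp

lemma norm_toLinfty_le {m : ℝ} (hm : 0 < m) (u : E) :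
    ‖E.toLinfty u‖ ≤ 2 * Real.sqrt (latticeSum / m) * ‖shiftedA (m ^ 2) u‖ :=
  norm_toLp_toL2_le hm u

/-! ### The bilinear map `B` -/

/-- The pointwise product `(a, b) ↦ aⁱ b`. -/
def coordSMul (i : Fin 2) : Vec →L[ℝ] Vec →L[ℝ] Vec :=
  (ContinuousLinearMap.lsmul ℝ ℝ).comp (EuclideanSpace.proj i)

lemma norm_coordSMul_le (i : Fin 2) : ‖coordSMul i‖ ≤ 1 :=
  ContinuousLinearMap.opNorm_le_bound _ zero_le_one fun a => by
    rw [one_mul]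
    exact (ContinuousLinearMap.opNorm_lsmul_apply_le _).trans (PiLp.norm_apply_le a i)

/-- The partial derivative `∂v/∂xⁱ` of `v ∈ E`. -/
def E.partial (i : Fin 2) : E →L[ℝ] L2 := (PiLp.proj 2 (fun _ : Fin 2 => L2) i).comp E.grad

/-- `(u · ∇) v` as a bilinear map from `E` to `L²`; see `coeFn_convectionL2`. -/
def convectionL2 : E →L[ℝ] E →L[ℝ] L2 :=
  ∑ i : Fin 2, ((coordSMul i).holderL torusMeasure ⊤ 2 2).bilinearComp E.toLinfty (E.partial i)

lemma convectionL2_apply (u v : E) : convectionL2 u v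
    = ∑ i, (coordSMul i).holder 2 (E.toLinfty u) (E.partial i v) := by
  simp only [convectionL2, sum_apply, ContinuousLinearMap.bilinearComp_apply,
    ContinuousLinearMap.holderL_apply_apply]

lemma coeFn_convectionL2 (u v : E) :
    convectionL2 u v =ᵐ[torusMeasure] convection (E.toV u) (E.toV v) := by
  rw [convectionL2_apply, Fin.sum_univ_two]
  filter_upwards [Lp.coeFn_add ((coordSMul 0).holder 2 (E.toLinfty u) (E.partial 0 v))
      ((coordSMul 1).holder 2 (E.toLinfty u) (E.partial 1 v)),
    (coordSMul 0).coeFn_holder (r := 2) (E.toLinfty u) (E.partial 0 v),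
    (coordSMul 1).coeFn_holder (r := 2) (E.toLinfty u) (E.partial 1 v),
    coeFn_toLinfty u] with x hadd h0 h1 hu
  rw [hadd, Pi.add_apply, h0, h1, hu, convection, Fin.sum_univ_two]
  rfl

lemma norm_convectionL2_le (u v : E) :
    ‖convectionL2 u v‖ ≤ 2 * ‖E.toLinfty u‖ * ‖E.grad v‖ := by
  have hterm (i : Fin 2) : ‖(coordSMul i).holder 2 (E.toLinfty u) (E.partial i v)‖
      ≤ 1 * ‖E.toLinfty u‖ * ‖E.grad v‖ := by
    refine ((coordSMul i).norm_holder_apply_apply_le _ _).trans ?_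
    gcongr
    exacts [norm_coordSMul_le i, PiLp.norm_apply_le (E.grad v) i]
  rw [convectionL2_apply, Fin.sum_univ_two]
  linarith [norm_add_le ((coordSMul 0).holder 2 (E.toLinfty u) (E.partial 0 v))
    ((coordSMul 1).holder 2 (E.toLinfty u) (E.partial 1 v)), hterm 0, hterm 1]

lemma memLp_convection (u v : E) : MemLp (convection (E.toV u) (E.toV v)) 2 torusMeasure :=
  (memLp_congr_ae (coeFn_convectionL2 u v)).1 (Lp.memLp _)

lemma B_eq (u v : E) : B (E.toV u) v = H.proj (convectionL2 u v) := by
  rw [B, leray, dif_pos (memLp_convection u v)]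
  congr 1
  exact Lp.ext ((memLp_convection u v).coeFn_toLp.trans (coeFn_convectionL2 u v).symm)

lemma norm_B_le (u v : E) : ‖B (E.toV u) v‖ ≤ 2 * ‖E.toLinfty u‖ * ‖E.grad v‖ := by
  rw [B_eq]
  exact (solenoidal.norm_orthogonalProjectionOnto_apply_le _).trans (norm_convectionL2_le u v)

/-! ### The lower order part of the linearized operator -/

/-- `ω ↦ -B'(ū) ω + |∇ū|² ω + 2 ⟨∇ū, ∇ω⟩ ū`, the lower order part of the linearized operator. -/
def lowerOrder (ubar : E) : E →L[ℝ] H :=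
  -H.proj.comp (convectionL2 ubar + convectionL2.flip ubar) + ‖E.grad ubar‖ ^ 2 • E.toH
    + (2 • (innerSL ℝ (E.grad ubar)).comp E.grad).smulRight (E.toH ubar)

lemma lowerOrder_apply (ubar ω : E) : lowerOrder ubar ω = -B' ubar ω
    + ‖E.grad ubar‖ ^ 2 • E.toH ω + (2 * inner ℝ (E.grad ubar) (E.grad ω)) • E.toH ubar := by
  simp [lowerOrder, B', B_eq]

lemma G_eq (ubar ω : E) (U : H) : G ubar U ω = U + lowerOrder ubar ω := by
  rw [G, lowerOrder_apply]; abel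

lemma norm_lowerOrder_apply_le (ubar ω : E) : ‖lowerOrder ubar ω‖
    ≤ 2 * ‖E.toLinfty ubar‖ * ‖E.grad ω‖ + 2 * ‖E.toLinfty ω‖ * ‖E.grad ubar‖
      + ‖E.grad ubar‖ ^ 2 * ‖E.toH ω‖ + 2 * (‖E.grad ubar‖ * ‖E.grad ω‖) * ‖E.toH ubar‖ := by
  have hB' : ‖-B' ubar ω‖ ≤ ‖B (E.toV ubar) ω‖ + ‖B (E.toV ω) ubar‖ := by
    rw [norm_neg]; exact norm_add_le _ _
  have hzeroth : ‖‖E.grad ubar‖ ^ 2 • E.toH ω‖ = ‖E.grad ubar‖ ^ 2 * ‖E.toH ω‖ := by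
    rw [norm_smul, Real.norm_of_nonneg (by positivity)]
  have hinner : ‖(2 * inner ℝ (E.grad ubar) (E.grad ω)) • E.toH ubar‖
      ≤ 2 * (‖E.grad ubar‖ * ‖E.grad ω‖) * ‖E.toH ubar‖ := by
    rw [norm_smul, norm_mul, Real.norm_ofNat]
    gcongr
    exact norm_inner_le_norm _ _
  rw [lowerOrder_apply]
  refine norm_add₃_le.trans ?_
  linarith [norm_B_le ubar ω, norm_B_le ω ubar]

lemma E.norm_toV_le (u : E) : ‖E.toV u‖ ≤ ‖u‖ := WithLp.norm_fst_le V u.1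

lemma E.norm_toH_le (u : E) : ‖E.toH u‖ ≤ ‖u‖ :=
  (WithLp.norm_fst_le H (E.toV u).1).trans (E.norm_toV_le u)

lemma E.norm_grad_le (u : E) : ‖E.grad u‖ ≤ ‖u‖ :=
  (WithLp.norm_snd_le H (E.toV u).1).trans (E.norm_toV_le u)

lemma opNorm_lowerOrder_le (ubar : E) : ‖lowerOrder ubar‖
    ≤ ‖E.grad ubar‖ ^ 2 + 4 * ‖E.toLinfty‖ * ‖ubar‖ + 2 * ‖E.toH ubar‖ * ‖E.grad ubar‖ := by
  refine ContinuousLinearMap.opNorm_le_bound _ (by positivity) fun ω => ?_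
  calc ‖lowerOrder ubar ω‖ ≤ _ := norm_lowerOrder_apply_le ubar ω
    _ ≤ 2 * (‖E.toLinfty‖ * ‖ubar‖) * ‖ω‖ + 2 * (‖E.toLinfty‖ * ‖ω‖) * ‖ubar‖
        + ‖E.grad ubar‖ ^ 2 * ‖ω‖ + 2 * (‖E.grad ubar‖ * ‖ω‖) * ‖E.toH ubar‖ := by
      gcongr
      exacts [E.toLinfty.le_opNorm _, E.norm_grad_le _, E.toLinfty.le_opNorm _, E.norm_grad_le _,
        E.norm_toH_le _, E.norm_grad_le _]
    _ = _ := by ring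

/-- A bound for the lower order part relative to `A + m²`. -/
def relativeBound (ubar : E) (m : ℝ) : ℝ :=
  2 * ‖E.toLinfty ubar‖ * m⁻¹ + 4 * Real.sqrt (latticeSum / m) * ‖E.grad ubar‖
    + ‖E.grad ubar‖ ^ 2 * (m ^ 2)⁻¹ + 2 * ‖E.grad ubar‖ * ‖E.toH ubar‖ * m⁻¹

lemma norm_lowerOrder_le_relativeBound_mul (ubar : E) {m : ℝ} (hm : 0 < m) (ω : E) :
    ‖lowerOrder ubar ω‖ ≤ relativeBound ubar m * ‖shiftedA (m ^ 2) ω‖ := by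
  have hgrad : ‖E.grad ω‖ ≤ m⁻¹ * ‖shiftedA (m ^ 2) ω‖ := by
    rw [inv_mul_eq_div, le_div_iff₀' hm]
    refine le_of_sq_le_sq ?_ (norm_nonneg _)
    rw [mul_pow]
    exact mul_norm_grad_sq_le (sq_nonneg m) ω
  have htoH : ‖E.toH ω‖ ≤ (m ^ 2)⁻¹ * ‖shiftedA (m ^ 2) ω‖ := by
    rw [inv_mul_eq_div, le_div_iff₀' (by positivity)]
    exact mul_norm_toH_le_norm_shiftedA (sq_nonneg m) ω
  calc ‖lowerOrder ubar ω‖ ≤ _ := norm_lowerOrder_apply_le ubar ω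
    _ ≤ 2 * ‖E.toLinfty ubar‖ * (m⁻¹ * ‖shiftedA (m ^ 2) ω‖)
        + 2 * (2 * Real.sqrt (latticeSum / m) * ‖shiftedA (m ^ 2) ω‖) * ‖E.grad ubar‖
        + ‖E.grad ubar‖ ^ 2 * ((m ^ 2)⁻¹ * ‖shiftedA (m ^ 2) ω‖)
        + 2 * (‖E.grad ubar‖ * (m⁻¹ * ‖shiftedA (m ^ 2) ω‖)) * ‖E.toH ubar‖ := by
      gcongr
      exact norm_toLinfty_le hm ω
    _ = _ := by rw [relativeBound]; ring

lemma tendsto_relativeBound (ubar : E) :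
    Filter.Tendsto (relativeBound ubar) Filter.atTop (nhds 0) := by
  have hinv := tendsto_inv_atTop_zero (𝕜 := ℝ)
  have hsqrt := (hinv.const_mul latticeSum).sqrt
  have hsum := (((hinv.const_mul (2 * ‖E.toLinfty ubar‖)).add
    ((hsqrt.const_mul 4).mul_const ‖E.grad ubar‖)).add
    ((hinv.pow 2).const_mul (‖E.grad ubar‖ ^ 2))).add
    (hinv.const_mul (2 * ‖E.grad ubar‖ * ‖E.toH ubar‖))
  simpa [relativeBound, div_eq_mul_inv] using! hsum

lemma exists_norm_lowerOrder_le (ubar : E) :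
    ∃ μ : ℝ, 0 ≤ μ ∧ ∀ ω, ‖lowerOrder ubar ω‖ ≤ 2⁻¹ * ‖shiftedA μ ω‖ := by
  obtain ⟨m, hsmall, hm⟩ := (((tendsto_relativeBound ubar).eventually_lt_const
    (by norm_num : (0 : ℝ) < 2⁻¹)).and (Filter.eventually_gt_atTop 0)).exists
  exact ⟨m ^ 2, sq_nonneg m, fun ω =>
    (norm_lowerOrder_le_relativeBound_mul ubar hm ω).trans (by gcongr)⟩

/-! ### Lipschitz continuity of `G` -/

lemma norm_toE_le {T : ℝ} (ω : X T) : ‖ω.toE‖ ≤ ‖ω‖ := norm_snd_le ω.1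

lemma X.toE_sub {T : ℝ} (ω ω' : X T) : (ω - ω').toE = ω.toE - ω'.toE := rfl

lemma exists_lipschitz_G (ubar : E) {T : ℝ} (U : L2Time T H) :
    ∃ Φ : X T → L2Time T H,
      (∀ ω : X T, ∀ᵐ t ∂timeMeasure T, Φ ω t = G ubar (U t) (ω.toE t)) ∧
      ∀ ω₁ ω₂ : X T, ‖Φ ω₁ - Φ ω₂‖ ≤ ‖lowerOrder ubar‖ * ‖ω₁ - ω₂‖ := by
  refine ⟨fun ω => U + (lowerOrder ubar).compLpL 2 (timeMeasure T) ω.toE, fun ω => ?_,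
    fun ω₁ ω₂ => ?_⟩
  · filter_upwards [Lp.coeFn_add U ((lowerOrder ubar).compLpL 2 (timeMeasure T) ω.toE),
      (lowerOrder ubar).coeFn_compLpL (p := 2) ω.toE] with t hadd hcomp
    rw [hadd, Pi.add_apply, hcomp, G_eq]
  · rw [add_sub_add_left_eq_sub, ← map_sub, ← X.toE_sub]
    refine ((lowerOrder ubar).norm_compLp_le _).trans ?_
    gcongr
    exact norm_toE_le _

/-! ### Scalar linear equations with square integrable right hand side -/

/-- On `[0, T]` the function `f` is the primitive of the integrable function `f'`. -/
def IsPrimitive (T : ℝ) (f f' : ℝ → ℝ) : Prop :=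
  IntervalIntegrable f' volume 0 T ∧ ∀ t ∈ Icc 0 T, f t = f 0 + ∫ s in 0..t, f' s

lemma intervalIntegrable_of_mem_Icc {T t : ℝ} {f : ℝ → ℝ} (hf : IntervalIntegrable f volume 0 T)
    (ht : t ∈ Icc 0 T) : IntervalIntegrable f volume 0 t :=
  hf.mono_set <| by
    rw [uIcc_of_le ht.1, uIcc_of_le (ht.1.trans ht.2)]
    exact Icc_subset_Icc_right ht.2

lemma integral_mul_primitive_add_primitive_mul {t : ℝ} {f' g' : ℝ → ℝ}
    (hf : IntervalIntegrable f' volume 0 t) (hg : IntervalIntegrable g' volume 0 t) (a b : ℝ) :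
    ∫ s in 0..t, (f' s * (b + ∫ r in 0..s, g' r) + (a + ∫ r in 0..s, f' r) * g' s)
      = (a + ∫ s in 0..t, f' s) * (b + ∫ s in 0..t, g' s) - a * b := by
  have hac {h' : ℝ → ℝ} (hh : IntervalIntegrable h' volume 0 t) (c : ℝ) :
      AbsolutelyContinuousOnInterval (fun s => c + ∫ r in 0..s, h' r) 0 t :=
    (contDiff_const (n := 1)).contDiffOn.absolutelyContinuousOnInterval.add
      (hh.absolutelyContinuousOnInterval_intervalIntegral left_mem_uIcc)
  have hparts := (hac hf a).integral_deriv_mul_eq_sub (hac hg b)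
  simp only [intervalIntegral.integral_same, add_zero] at hparts
  rw [← hparts]
  refine intervalIntegral.integral_congr_ae ?_
  filter_upwards [hf.ae_hasDerivAt_integral, hg.ae_hasDerivAt_integral] with s hfs hgs hs
  have hs' : s ∈ uIcc 0 t := uIoc_subset_uIcc hs
  rw [((hfs hs' 0 left_mem_uIcc).const_add a).deriv, ((hgs hs' 0 left_mem_uIcc).const_add b).deriv]

namespace IsPrimitive

variable {T : ℝ} {f f' g g' : ℝ → ℝ}

lemma congr (hT : 0 ≤ T) (h : IsPrimitive T f f') (hg : EqOn f g (Icc 0 T))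
    (hg' : EqOn f' g' (Icc 0 T)) : IsPrimitive T g g' := by
  refine ⟨h.1.congr ?_, fun t ht => ?_⟩
  · rw [uIoc_of_le hT]
    exact hg'.mono Ioc_subset_Icc_self
  · rw [← hg ht, ← hg (left_mem_Icc.2 hT), h.2 t ht,
      intervalIntegral.integral_congr fun s hs => hg' ?_]
    rw [uIcc_of_le ht.1] at hs
    exact ⟨hs.1, hs.2.trans ht.2⟩

lemma of_hasDerivAt (h : ∀ t, HasDerivAt f (f' t) t) (hc : Continuous f') :
    IsPrimitive T f f' := by
  refine ⟨hc.intervalIntegrable _ _, fun t _ => ?_⟩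
  rw [intervalIntegral.integral_eq_sub_of_hasDerivAt (fun s _ => h s) (hc.intervalIntegrable _ _)]
  ring

lemma of_integral (h : IntervalIntegrable f' volume 0 T) (a : ℝ) :
    IsPrimitive T (fun t => a + ∫ s in 0..t, f' s) f' :=
  ⟨h, fun t _ => by simp⟩

lemma intervalIntegrable (h : IsPrimitive T f f') {t : ℝ} (ht : t ∈ Icc 0 T) :
    IntervalIntegrable f' volume 0 t :=
  intervalIntegrable_of_mem_Icc h.1 ht

lemma sub_eq_integral (h : IsPrimitive T f f') {s t : ℝ} (hs : s ∈ Icc 0 T) (ht : t ∈ Icc 0 T) :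
    f t - f s = ∫ r in s..t, f' r := by
  rw [h.2 t ht, h.2 s hs, ← intervalIntegral.integral_interval_sub_left
    (h.intervalIntegrable ht) (h.intervalIntegrable hs)]
  ring

lemma continuousOn (hT : 0 ≤ T) (h : IsPrimitive T f f') : ContinuousOn f (Icc 0 T) := by
  have hc := (intervalIntegral.continuousOn_primitive_interval' h.1 left_mem_uIcc).const_add (f 0)
  rw [uIcc_of_le hT] at hc
  exact hc.congr h.2

lemma mul (hT : 0 ≤ T) (hf : IsPrimitive T f f') (hg : IsPrimitive T g g') :
    IsPrimitive T (fun t => f t * g t) (fun t => f' t * g t + f t * g' t) := by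
  refine ⟨?_, fun t ht => ?_⟩
  · have hcf := hf.continuousOn hT
    have hcg := hg.continuousOn hT
    rw [← uIcc_of_le hT] at hcf hcg
    exact (hf.1.mul_continuousOn hcg).add (hg.1.continuousOn_mul hcf)
  · have hparts := integral_mul_primitive_add_primitive_mul (hf.intervalIntegrable ht)
      (hg.intervalIntegrable ht) (f 0) (g 0)
    have hcongr : ∫ s in 0..t, (f' s * g s + f s * g' s) = ∫ s in 0..t,
        (f' s * (g 0 + ∫ r in 0..s, g' r) + (f 0 + ∫ r in 0..s, f' r) * g' s) := by
      refine intervalIntegral.integral_congr fun s hs => ?_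
      rw [uIcc_of_le ht.1] at hs
      have hs' : s ∈ Icc 0 T := ⟨hs.1, hs.2.trans ht.2⟩
      simp only [← hf.2 s hs', ← hg.2 s hs']
    rw [hcongr, hparts, ← hf.2 t ht, ← hg.2 t ht]
    ring

end IsPrimitive

lemma isPrimitive_exp (T c : ℝ) :
    IsPrimitive T (fun t => Real.exp (c * t)) (fun t => c * Real.exp (c * t)) :=
  IsPrimitive.of_hasDerivAt
    (fun t => by simpa [mul_comm] using ((hasDerivAt_id t).const_mul c).exp) (by fun_prop)

lemma exists_scalar_solution {T : ℝ} (hT : 0 ≤ T) {g : ℝ → ℝ}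
    (hg : IntervalIntegrable g volume 0 T) (l a : ℝ) :
    ∃ y : ℝ → ℝ, y 0 = a ∧ IsPrimitive T y fun t => g t - l * y t := by
  have hprim := IsPrimitive.of_integral (hg.continuousOn_mul
    (g := fun t => Real.exp (l * t)) (by fun_prop)) a
  -- the Duhamel formula
  refine ⟨fun t => Real.exp (-l * t) * (a + ∫ s in 0..t, Real.exp (l * s) * g s), by simp, ?_⟩
  convert (isPrimitive_exp T (-l)).mul hT hprim using 2 with t
  have hexp : Real.exp (-l * t) * Real.exp (l * t) = 1 := by
    rw [← Real.exp_add]; simp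
  linear_combination (-g t) * hexp

lemma IsPrimitive.exp_mul {T : ℝ} (hT : 0 ≤ T) {y g : ℝ → ℝ} {l : ℝ}
    (hy : IsPrimitive T y fun t => g t - l * y t) (μ : ℝ) :
    IsPrimitive T (fun t => Real.exp (-μ * t) * y t) fun t =>
      Real.exp (-μ * t) * g t - (l + μ) * (Real.exp (-μ * t) * y t) := by
  convert (isPrimitive_exp T (-μ)).mul hT hy using 2 with t
  ring

lemma scalar_energy_le {T : ℝ} (hT : 0 ≤ T) {y g : ℝ → ℝ} {l : ℝ}
    (hy : IsPrimitive T y fun t => g t - l * y t)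
    (hg : IntervalIntegrable (fun t => g t ^ 2) volume 0 T) {t : ℝ} (ht : t ∈ Icc 0 T) :
    l * y t ^ 2 + ∫ s in 0..t, (l * y s) ^ 2 ≤ l * y 0 ^ 2 + ∫ s in 0..t, g s ^ 2 := by
  have hsq := hy.mul hT hy
  have hgi := intervalIntegrable_of_mem_Icc hg ht
  have hyi : IntervalIntegrable (fun s => (l * y s) ^ 2) volume 0 t := by
    refine ContinuousOn.intervalIntegrable ?_
    rw [uIcc_of_le ht.1]
    exact (((hy.continuousOn hT).mono (Icc_subset_Icc_right ht.2)).const_smul l).pow 2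
  -- `2 l y y' = 2 (l y) (g - l y) ≤ g² - (l y)²`
  have hderiv : l * ∫ s in 0..t, ((g s - l * y s) * y s + y s * (g s - l * y s))
      ≤ (∫ s in 0..t, g s ^ 2) - ∫ s in 0..t, (l * y s) ^ 2 := by
    rw [← intervalIntegral.integral_const_mul, ← intervalIntegral.integral_sub hgi hyi]
    refine intervalIntegral.integral_mono_on ht.1 ((hsq.intervalIntegrable ht).const_mul _)
      (hgi.sub hyi) fun s _ => ?_
    nlinarith [sq_nonneg (g s - l * y s)]
  have hdiff : l * y t ^ 2 = l * y 0 ^ 2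
      + l * ∫ s in 0..t, ((g s - l * y s) * y s + y s * (g s - l * y s)) := by
    linear_combination l * hsq.2 t ht
  linarith

/-! ### Integrals over the time interval -/

instance (T : ℝ) : IsFiniteMeasure (timeMeasure T) :=
  ⟨by
    rw [Measure.comap_apply _ Subtype.val_injective (fun s hs => measurableSet_Icc.subtype_image hs)
      _ MeasurableSet.univ, image_univ, Subtype.range_coe]
    exact measure_Icc_lt_top⟩

lemma map_timeMeasure (T : ℝ) :
    (timeMeasure T).map Subtype.val = volume.restrict (Icc (0 : ℝ) T) := by
  rw [(MeasurableEmbedding.subtype_coe measurableSet_Icc).map_comap, Subtype.range_coe]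

section

variable {F : Type*} [NormedAddCommGroup F] {T : ℝ}

lemma intervalIntegrable_iff_integrable_timeMeasure (hT : 0 ≤ T) {f : ℝ → F} :
    IntervalIntegrable f volume 0 T
      ↔ Integrable (fun t : Icc (0 : ℝ) T => f t) (timeMeasure T) := by
  rw [intervalIntegrable_iff_integrableOn_Icc_of_le hT, IntegrableOn, ← map_timeMeasure,
    (MeasurableEmbedding.subtype_coe measurableSet_Icc).integrable_map_iff]
  rfl

lemma setIntegral_timeMeasure [NormedSpace ℝ F] (f : ℝ → F) {s t : Icc (0 : ℝ) T} (hst : s ≤ t) :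
    ∫ r in Ioc s t, f r ∂timeMeasure T = ∫ r in (s : ℝ)..t, f r := by
  have hsub : Ioc (s : ℝ) t ⊆ Icc 0 T := fun r hr => ⟨s.2.1.trans hr.1.le, hr.2.trans t.2.2⟩
  have hrestrict : (volume : Measure ℝ).restrict (Ioc (s : ℝ) t)
      = ((timeMeasure T).map Subtype.val).restrict (Ioc (s : ℝ) t) := by
    rw [map_timeMeasure, Measure.restrict_restrict measurableSet_Ioc, inter_eq_left.2 hsub]
  rw [intervalIntegral.integral_of_le hst, hrestrict,
    (MeasurableEmbedding.subtype_coe measurableSet_Icc).setIntegral_map]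
  rfl

lemma integral_timeMeasure [NormedSpace ℝ F] (hT : 0 ≤ T) (f : ℝ → F) :
    ∫ t : Icc (0 : ℝ) T, f t ∂timeMeasure T = ∫ t in 0..T, f t := by
  rw [intervalIntegral.integral_of_le hT, ← integral_Icc_eq_integral_Ioc, ← map_timeMeasure,
    (MeasurableEmbedding.subtype_coe measurableSet_Icc).integral_map]

end

/-! ### Exponential weights in time -/

section

variable {T : ℝ} {F : Type} [NormedAddCommGroup F] [NormedSpace ℝ F]

lemma memLp_weight (μ : ℝ) (f : L2Time T F) :
    MemLp (fun t : Icc (0 : ℝ) T => Real.exp (-μ * t) • f t) 2 (timeMeasure T) := by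
  have hc : Continuous fun t : Icc (0 : ℝ) T => Real.exp (-μ * t) := by fun_prop
  obtain ⟨C, hC⟩ := isCompact_univ.exists_bound_of_continuousOn hc.continuousOn
  refine (Lp.memLp f).of_le_mul (c := C)
    (hc.aestronglyMeasurable.smul (Lp.memLp f).aestronglyMeasurable) (ae_of_all _ fun t => ?_)
  rw [norm_smul]
  gcongr
  exact hC t (mem_univ t)

/-- Multiplication by the weight `exp (-μ t)` in `L²(0, T; F)`. -/
def weight (μ : ℝ) (f : L2Time T F) : L2Time T F := (memLp_weight μ f).toLp _

lemma coeFn_weight (μ : ℝ) (f : L2Time T F) :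
    ∀ᵐ t ∂timeMeasure T, weight μ f t = Real.exp (-μ * t) • f t :=
  (memLp_weight μ f).coeFn_toLp

lemma weight_sub (μ : ℝ) (f g : L2Time T F) : weight μ (f - g) = weight μ f - weight μ g := by
  refine Lp.ext ?_
  filter_upwards [coeFn_weight μ (f - g), coeFn_weight μ f, coeFn_weight μ g, Lp.coeFn_sub f g,
    Lp.coeFn_sub (weight μ f) (weight μ g)] with t hfg hf hg hsub hsub'
  rw [hfg, hsub', Pi.sub_apply, hf, hg, hsub, Pi.sub_apply, smul_sub]

lemma weight_weight_neg (μ : ℝ) (f : L2Time T F) : weight μ (weight (-μ) f) = f := by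
  refine Lp.ext ?_
  filter_upwards [coeFn_weight μ (weight (-μ) f), coeFn_weight (-μ) f] with t hμ hneg
  rw [hμ, hneg, smul_smul, ← Real.exp_add]
  simp

lemma weight_injective (μ : ℝ) : Function.Injective (weight μ : L2Time T F → L2Time T F) :=
  Function.LeftInverse.injective (g := weight (-μ)) fun f => by
    simpa using weight_weight_neg (-μ) f

lemma norm_weight_le {F' : Type} [NormedAddCommGroup F'] [NormedSpace ℝ F'] (μ : ℝ) {c : ℝ}
    {f : L2Time T F} {g : L2Time T F'} (h : ∀ᵐ t ∂timeMeasure T, ‖f t‖ ≤ c * ‖g t‖) :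
    ‖weight μ f‖ ≤ c * ‖weight μ g‖ := by
  refine Lp.norm_le_mul_norm_of_ae_le_mul ?_
  filter_upwards [coeFn_weight μ f, coeFn_weight μ g, h] with t hf hg hfg
  rw [hf, hg, norm_smul, norm_smul, mul_left_comm]
  gcongr

end

/-! ### The Stokes evolution equation -/

section

variable {T : ℝ}

lemma X.toV_toE_ae_eq (ω : X T) : ∀ᵐ t ∂timeMeasure T, E.toV (ω.toE t) = ω.path t := ω.2

lemma X.path_sub (ω ω' : X T) (t : Icc (0 : ℝ) T) :
    (ω - ω').path t = ω.path t - ω'.path t := rfl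

lemma integrable_L2Time {F : Type} [NormedAddCommGroup F] (f : L2Time T F) :
    Integrable f (timeMeasure T) :=
  (Lp.memLp f).integrable (by norm_num)

lemma norm_sq_L2Time {F : Type} [NormedAddCommGroup F] [InnerProductSpace ℝ F] (f : L2Time T F) :
    ‖f‖ ^ 2 = ∫ t, ‖f t‖ ^ 2 ∂timeMeasure T := by
  rw [← real_inner_self_eq_norm_sq, L2.inner_def]
  simp only [real_inner_self_eq_norm_sq]

lemma memLp_inner_eigenH (f : L2Time T H) (k : NZFreq) :
    MemLp (fun t => inner ℝ (eigenH k) (f t)) 2 (timeMeasure T) :=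
  (innerSL ℝ (eigenH k)).comp_memLp f

lemma hasSum_integral_sq (f : L2Time T H) :
    HasSum (fun k => ∫ t, inner ℝ (eigenH k) (f t) ^ 2 ∂timeMeasure T) (‖f‖ ^ 2) := by
  rw [norm_sq_L2Time]
  refine hasSum_integral_of_dominated_convergence
    (fun k t => inner ℝ (eigenH k) (f t) ^ 2) (fun k => ?_) (fun k => ?_) ?_ ?_ ?_
  · exact (memLp_inner_eigenH f k).integrable_sq.aestronglyMeasurable
  · exact ae_of_all _ fun t => by rw [Real.norm_of_nonneg (sq_nonneg _)]
  · exact ae_of_all _ fun t => (hasSum_sq_inner_eigenH (f t)).summable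
  · simp only [(hasSum_sq_inner_eigenH _).tsum_eq]
    exact (Lp.memLp f).integrable_norm_pow (by norm_num)
  · exact ae_of_all _ fun t => hasSum_sq_inner_eigenH (f t)

/-- The coordinate of `f ∈ L²(0, T; H)` along `eigenH k`, as a function on the real line which is
constant on either side of `[0, T]`. -/
def modeL2 (hT : 0 ≤ T) (f : L2Time T H) (k : NZFreq) : ℝ → ℝ :=
  IccExtend hT fun t => inner ℝ (eigenH k) (f t)

/-- The coordinate of `ω ∈ X_T` along `eigenH k`, as a function on the real line which is constant
on either side of `[0, T]`. -/
def mode (hT : 0 ≤ T) (ω : X T) (k : NZFreq) : ℝ → ℝ :=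
  IccExtend hT fun t => inner ℝ (eigenH k) (V.toH (ω.path t))

lemma modeL2_coe (hT : 0 ≤ T) (f : L2Time T H) (k : NZFreq) (t : Icc (0 : ℝ) T) :
    modeL2 hT f k t = inner ℝ (eigenH k) (f t) :=
  IccExtend_val ..

lemma mode_coe (hT : 0 ≤ T) (ω : X T) (k : NZFreq) (t : Icc (0 : ℝ) T) :
    mode hT ω k t = inner ℝ (eigenH k) (V.toH (ω.path t)) :=
  IccExtend_val ..

lemma continuous_mode (hT : 0 ≤ T) (ω : X T) (k : NZFreq) : Continuous (mode hT ω k) :=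
  ((innerSL ℝ (eigenH k)).continuous.comp
    (V.toH.continuous.comp ω.path.continuous)).Icc_extend'

lemma intervalIntegrable_modeL2 (hT : 0 ≤ T) (f : L2Time T H) (k : NZFreq) :
    IntervalIntegrable (modeL2 hT f k) volume 0 T := by
  simp only [intervalIntegrable_iff_integrable_timeMeasure hT, modeL2_coe]
  exact (memLp_inner_eigenH f k).integrable (by norm_num)

lemma intervalIntegrable_modeL2_sq (hT : 0 ≤ T) (f : L2Time T H) (k : NZFreq) :
    IntervalIntegrable (fun t => modeL2 hT f k t ^ 2) volume 0 T := by
  simp only [intervalIntegrable_iff_integrable_timeMeasure hT, modeL2_coe]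
  exact (memLp_inner_eigenH f k).integrable_sq

/-- `ω ∈ X_T` solves `ω_t + A ω = f`. -/
def IsStokesSolution (f : L2Time T H) (ω : X T) : Prop :=
  ∃ w : L2Time T H, HasTimeDeriv ω.path w ∧ ∀ᵐ t ∂timeMeasure T, w t + A (ω.toE t) = f t

lemma inner_eigenH_setIntegral (hT : 0 ≤ T) {f w : L2Time T H} {ω : X T}
    (hw : ∀ᵐ t ∂timeMeasure T, w t + A (ω.toE t) = f t) (k : NZFreq) {s t : Icc (0 : ℝ) T}
    (hst : s ≤ t) : inner ℝ (eigenH k) (∫ r in Ioc s t, w r ∂timeMeasure T)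
      = ∫ r in (s : ℝ)..t, (modeL2 hT f k r - eigenvalue k * mode hT ω k r) := by
  rw [← integral_inner (integrable_L2Time w).integrableOn, ← setIntegral_timeMeasure _ hst]
  refine integral_congr_ae (ae_restrict_of_ae ?_)
  filter_upwards [hw, ω.toV_toE_ae_eq] with r hwr hωr
  rw [modeL2_coe, mode_coe, ← hωr, ← hwr, inner_add_right, inner_eigenH_A]
  exact (add_sub_cancel_right _ _).symm

lemma isStokesSolution_iff (hT : 0 ≤ T) {f : L2Time T H} {ω : X T} : IsStokesSolution f ω ↔
    ∀ k, IsPrimitive T (mode hT ω k)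
      fun t => modeL2 hT f k t - eigenvalue k * mode hT ω k t := by
  constructor
  · rintro ⟨w, hderiv, hw⟩ k
    refine ⟨(intervalIntegrable_modeL2 hT f k).sub
      (((continuous_mode hT ω k).intervalIntegrable _ _).const_mul _), fun t ht => ?_⟩
    have hinc := congrArg (inner ℝ (eigenH k)) (hderiv ⟨0, left_mem_Icc.2 hT⟩ ⟨t, ht⟩ ht.1)
    rw [inner_eigenH_setIntegral hT hw k ht.1, inner_sub_right, ← mode_coe hT, ← mode_coe hT,
      sub_eq_iff_eq_add'] at hinc
    exact hinc
  · intro hmode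
    have hw : ∀ᵐ t ∂timeMeasure T,
        (f - A.compLpL 2 (timeMeasure T) ω.toE) t + A (ω.toE t) = f t := by
      filter_upwards [Lp.coeFn_sub f (A.compLpL 2 (timeMeasure T) ω.toE),
        A.coeFn_compLpL (p := 2) ω.toE] with t hsub hA
      rw [hsub, Pi.sub_apply, hA, sub_add_cancel]
    refine ⟨_, fun s t hst => ext_inner_eigenH fun k => ?_, hw⟩
    rw [inner_eigenH_setIntegral hT hw k hst, inner_sub_right, ← mode_coe hT, ← mode_coe hT]
    exact (hmode k).sub_eq_integral s.2 t.2

lemma HasTimeDeriv.sub {ω ω' : X T} {w w' : L2Time T H} (h : HasTimeDeriv ω.path w)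
    (h' : HasTimeDeriv ω'.path w') : HasTimeDeriv (ω - ω').path (w - w') := by
  intro s t hst
  rw [integral_congr_ae (ae_restrict_of_ae (Lp.coeFn_sub w w'))]
  simp only [Pi.sub_apply]
  rw [integral_sub (integrable_L2Time w).integrableOn (integrable_L2Time w').integrableOn,
    ← h s t hst, ← h' s t hst, X.path_sub, X.path_sub, map_sub, map_sub]
  abel

lemma IsStokesSolution.sub {f f' : L2Time T H} {ω ω' : X T} (h : IsStokesSolution f ω)
    (h' : IsStokesSolution f' ω') : IsStokesSolution (f - f') (ω - ω') := by
  obtain ⟨w, hderiv, hw⟩ := h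
  obtain ⟨w', hderiv', hw'⟩ := h'
  refine ⟨w - w', hderiv.sub hderiv', ?_⟩
  rw [X.toE_sub]
  filter_upwards [hw, hw', Lp.coeFn_sub w w', Lp.coeFn_sub f f', Lp.coeFn_sub ω.toE ω'.toE]
    with t hwt hwt' hwsub hfsub hωsub
  rw [hwsub, hfsub, hωsub, Pi.sub_apply, Pi.sub_apply, Pi.sub_apply, ← hwt, ← hwt', map_sub]
  abel

/-! ### The weighted energy estimate -/

/-- `(A + μ) ω` as an element of `L²(0, T; H)`. -/
abbrev shiftedPath (μ : ℝ) (ω : X T) : L2Time T H :=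
  (shiftedA μ).compLpL 2 (timeMeasure T) ω.toE

lemma integral_inner_weight_sq (hT : 0 ≤ T) (μ : ℝ) (f : L2Time T H) (k : NZFreq) :
    ∫ t, inner ℝ (eigenH k) (weight μ f t) ^ 2 ∂timeMeasure T
      = ∫ t in 0..T, (Real.exp (-μ * t) * modeL2 hT f k t) ^ 2 := by
  rw [← integral_timeMeasure hT]
  refine integral_congr_ae ?_
  filter_upwards [coeFn_weight μ f] with t ht
  rw [ht, inner_smul_right, modeL2_coe]

lemma integral_inner_weight_shiftedPath_sq (hT : 0 ≤ T) (μ : ℝ) (ω : X T) (k : NZFreq) :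
    ∫ t, inner ℝ (eigenH k) (weight μ (shiftedPath μ ω) t) ^ 2 ∂timeMeasure T
      = ∫ t in 0..T, ((eigenvalue k + μ) * (Real.exp (-μ * t) * mode hT ω k t)) ^ 2 := by
  rw [← integral_timeMeasure hT]
  refine integral_congr_ae ?_
  filter_upwards [coeFn_weight μ (shiftedPath μ ω), (shiftedA μ).coeFn_compLpL (p := 2) ω.toE,
    ω.toV_toE_ae_eq] with t hweight hA hωt
  rw [hweight, hA, inner_smul_right, inner_eigenH_shiftedA, mode_coe, ← hωt, mul_left_comm]
  rfl

lemma IsStokesSolution.norm_weight_shiftedPath_le (hT : 0 ≤ T) {f : L2Time T H} {ω : X T}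
    (h : IsStokesSolution f ω) (h0 : ω.path ⟨0, left_mem_Icc.2 hT⟩ = 0) {μ : ℝ} (hμ : 0 ≤ μ) :
    ‖weight μ (shiftedPath μ ω)‖ ≤ ‖weight μ f‖ := by
  refine le_of_sq_le_sq (hasSum_le (fun k => ?_) (hasSum_integral_sq _) (hasSum_integral_sq _))
    (norm_nonneg _)
  have hsq : IntervalIntegrable (fun t => (Real.exp (-μ * t) * modeL2 hT f k t) ^ 2)
      volume 0 T := by
    simp only [mul_pow]
    exact (intervalIntegrable_modeL2_sq hT f k).continuousOn_mul (by fun_prop)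
  have henergy := scalar_energy_le hT (((isStokesSolution_iff hT).1 h k).exp_mul hT μ) hsq
    (right_mem_Icc.2 hT)
  have hstart : mode hT ω k 0 = 0 := by
    rw [mode, IccExtend_left, h0, map_zero, inner_zero_right]
  have hend : 0 ≤ (eigenvalue k + μ) * (Real.exp (-μ * T) * mode hT ω k T) ^ 2 := by
    positivity [eigenvalue_nonneg k]
  rw [integral_inner_weight_shiftedPath_sq hT, integral_inner_weight_sq hT]
  rw [hstart] at henergy
  linarith

/-! ### Superpositions of eigenfunctions -/

instance : CompleteSpace (X T) := by
  have hgraph : (graphX T : Set (C(Icc (0 : ℝ) T, V) × L2Time T E))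
      = {w | E.toV.compLpL 2 (timeMeasure T) w.2
        = ContinuousMap.toLp (E := V) 2 (timeMeasure T) ℝ w.1} := by
    ext w
    change (∀ᵐ t ∂timeMeasure T, E.toV (w.2 t) = w.1 t) ↔ _ = _
    rw [Lp.ext_iff]
    refine Filter.eventually_congr ?_
    filter_upwards [E.toV.coeFn_compLpL (p := 2) w.2,
      ContinuousMap.coeFn_toLp (E := V) (p := 2) (𝕜 := ℝ) (timeMeasure T) w.1] with t htoV htoLp
    rw [htoV, htoLp]
  have hclosed : IsClosed (graphX T : Set (C(Icc (0 : ℝ) T, V) × L2Time T E)) := by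
    rw [hgraph]
    exact isClosed_eq (by fun_prop) (by fun_prop)
  exact hclosed.completeSpace_coe

/-- A continuous `E`-valued path as an element of `X_T`. -/
def ofPath : C(Icc (0 : ℝ) T, E) →ₗ[ℝ] X T :=
  LinearMap.codRestrict (graphX T)
    ((E.toV.compLeftContinuous ℝ (Icc (0 : ℝ) T)).prod
      (ContinuousMap.toLp (E := E) 2 (timeMeasure T) ℝ)).toLinearMap fun c => by
    change ∀ᵐ t ∂timeMeasure T, E.toV (ContinuousMap.toLp (E := E) 2 (timeMeasure T) ℝ c t)
      = E.toV (c t)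
    filter_upwards [ContinuousMap.coeFn_toLp (E := E) (p := 2) (𝕜 := ℝ) (timeMeasure T) c]
      with t ht
    rw [ht]

lemma norm_ofPath_le {c : C(Icc (0 : ℝ) T, E)} {M : ℝ} (hsup : ∀ t, ‖E.toV (c t)‖ ^ 2 ≤ M)
    (hint : ∫ t, ‖c t‖ ^ 2 ∂timeMeasure T ≤ M) : ‖ofPath c‖ ≤ Real.sqrt M := by
  refine max_le ?_ ?_
  · refine (ContinuousMap.norm_le _ (Real.sqrt_nonneg _)).2 fun t => ?_
    exact Real.le_sqrt_of_sq_le (hsup t)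
  · refine Real.le_sqrt_of_sq_le ?_
    change ‖ContinuousMap.toLp (E := E) 2 (timeMeasure T) ℝ c‖ ^ 2 ≤ M
    rw [norm_sq_L2Time]
    refine le_trans (le_of_eq (integral_congr_ae ?_)) hint
    filter_upwards [ContinuousMap.coeFn_toLp (E := E) (p := 2) (𝕜 := ℝ) (timeMeasure T) c]
      with t ht
    rw [ht]

/-- Evaluation at time `t`, as a continuous linear map on `X_T`. -/
def X.evalCLM (t : Icc (0 : ℝ) T) : X T →L[ℝ] V :=
  (ContinuousMap.evalCLM ℝ t).comp
    ((ContinuousLinearMap.fst ℝ C(Icc (0 : ℝ) T, V) (L2Time T E)).comp (graphX T).subtypeL)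

lemma A_sum_eigenE (s : Finset NZFreq) (a : NZFreq → ℝ) :
    A (∑ k ∈ s, a k • eigenE k) = ∑ k ∈ s, (eigenvalue k * a k) • eigenH k := by
  simp only [map_sum, map_smul, A_eigenE, smul_smul, mul_comm]

lemma norm_toV_sum_eigenE_sq_le (s : Finset NZFreq) (a : NZFreq → ℝ) :
    ‖E.toV (∑ k ∈ s, a k • eigenE k)‖ ^ 2 ≤ 2 * ∑ k ∈ s, eigenvalue k * a k ^ 2 := by
  have htoH : E.toH (∑ k ∈ s, a k • eigenE k) = ∑ k ∈ s, a k • eigenH k := by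
    simp only [map_sum, map_smul, toH_eigenE]
  rw [norm_toV_sq, ← real_inner_self_eq_norm_sq, htoH, A_sum_eigenE,
    orthonormal_eigenH.inner_sum, orthonormal_eigenH.inner_sum, two_mul]
  simp only [conj_trivial]
  refine add_le_add (Finset.sum_le_sum fun k _ => ?_) (Finset.sum_le_sum fun k _ => ?_)
  · nlinarith [one_le_eigenvalue k.2, sq_nonneg (a k)]
  · exact le_of_eq (by ring)

lemma norm_sum_eigenE_sq_le (s : Finset NZFreq) (a : NZFreq → ℝ) :
    ‖∑ k ∈ s, a k • eigenE k‖ ^ 2 ≤ 9 * ∑ k ∈ s, (eigenvalue k * a k) ^ 2 := by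
  have hA : ‖A (∑ k ∈ s, a k • eigenE k)‖ ^ 2 = ∑ k ∈ s, (eigenvalue k * a k) ^ 2 := by
    rw [← real_inner_self_eq_norm_sq, A_sum_eigenE, orthonormal_eigenH.inner_sum]
    simp only [conj_trivial, sq]
  calc ‖∑ k ∈ s, a k • eigenE k‖ ^ 2 ≤ (3 * ‖A (∑ k ∈ s, a k • eigenE k)‖) ^ 2 := by
        gcongr
        exact norm_le_norm_A _
    _ = _ := by rw [mul_pow, hA]; norm_num

/-- The path `t ↦ y(t) eₖ` in the direction of the `k`-th eigenfunction, as an element of `X_T`. -/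
def eigenPath (k : NZFreq) (y : C(Icc (0 : ℝ) T, ℝ)) : X T :=
  ofPath (y • ContinuousMap.const _ (eigenE k))

lemma norm_sum_eigenPath_le {y : NZFreq → C(Icc (0 : ℝ) T, ℝ)} {D : NZFreq → ℝ}
    (hsup : ∀ (k : NZFreq) t, eigenvalue k * y k t ^ 2 ≤ D k)
    (hint : ∀ k : NZFreq, ∫ t, (eigenvalue k * y k t) ^ 2 ∂timeMeasure T ≤ D k)
    (s : Finset NZFreq) :
    ‖∑ k ∈ s, eigenPath k (y k)‖ ≤ Real.sqrt (9 * ∑ k ∈ s, D k) := by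
  have hsum (t : Icc (0 : ℝ) T) : (∑ k ∈ s, y k • ContinuousMap.const _ (eigenE k)) t
      = ∑ k ∈ s, y k t • eigenE k := by
    simp [ContinuousMap.sum_apply]
  simp only [eigenPath, ← map_sum]
  refine norm_ofPath_le (fun t => ?_) ?_
  · rw [hsum]
    have hnonneg : 0 ≤ ∑ k ∈ s, D k := Finset.sum_nonneg fun k _ =>
      (mul_nonneg (eigenvalue_nonneg k) (sq_nonneg (y k t))).trans (hsup k t)
    linarith [norm_toV_sum_eigenE_sq_le s fun k => y k t,
      Finset.sum_le_sum fun k (_ : k ∈ s) => hsup k t]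
  · have hquad (k : NZFreq) : Integrable (fun t => (eigenvalue k * y k t) ^ 2) (timeMeasure T) :=
      integrable_of_continuous (by fun_prop)
    simp only [hsum]
    calc ∫ t, ‖∑ k ∈ s, y k t • eigenE k‖ ^ 2 ∂timeMeasure T
        ≤ ∫ t, 9 * ∑ k ∈ s, (eigenvalue k * y k t) ^ 2 ∂timeMeasure T :=
          integral_mono (integrable_of_continuous (by fun_prop))
            ((integrable_finsetSum s fun k _ => hquad k).const_mul 9)
            fun t => norm_sum_eigenE_sq_le s _
      _ = 9 * ∑ k ∈ s, ∫ t, (eigenvalue k * y k t) ^ 2 ∂timeMeasure T := by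
          rw [integral_const_mul, integral_finsetSum s fun k _ => hquad k]
      _ ≤ 9 * ∑ k ∈ s, D k := by
          gcongr with k
          exact hint k

lemma summable_eigenPath {y : NZFreq → C(Icc (0 : ℝ) T, ℝ)} {D : NZFreq → ℝ} (hD : Summable D)
    (hsup : ∀ (k : NZFreq) t, eigenvalue k * y k t ^ 2 ≤ D k)
    (hint : ∀ k : NZFreq, ∫ t, (eigenvalue k * y k t) ^ 2 ∂timeMeasure T ≤ D k) :
    Summable fun k => eigenPath k (y k) := by
  rw [summable_iff_vanishing_norm]
  intro ε hε
  obtain ⟨s, hs⟩ := summable_iff_vanishing_norm.1 hD (ε ^ 2 / 9) (by positivity)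
  refine ⟨s, fun t ht => (norm_sum_eigenPath_le hsup hint t).trans_lt ?_⟩
  rw [Real.sqrt_lt' hε]
  linarith [(le_abs_self _).trans_lt (hs t ht)]

lemma inner_eigenH_eigenPath (k l : NZFreq) (y : C(Icc (0 : ℝ) T, ℝ)) (t : Icc (0 : ℝ) T) :
    inner ℝ (eigenH l) (V.toH ((eigenPath k y).path t)) = if k = l then y t else 0 := by
  change inner ℝ (eigenH l) (E.toH (y t • eigenE k)) = _
  rw [map_smul, inner_smul_right, toH_eigenE, orthonormal_iff_ite.1 orthonormal_eigenH]
  simp [eq_comm]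

lemma mode_tsum_eigenPath (hT : 0 ≤ T) {y : NZFreq → C(Icc (0 : ℝ) T, ℝ)}
    (hy : Summable fun k => eigenPath k (y k)) (k : NZFreq) (t : Icc (0 : ℝ) T) :
    mode hT (∑' l, eigenPath l (y l)) k t = y k t := by
  rw [mode_coe]
  have hsum := hy.hasSum.mapL ((innerSL ℝ (eigenH k)).comp (V.toH.comp (X.evalCLM t)))
  refine hsum.unique ((hasSum_ite_eq k (y k t)).congr_fun fun l => ?_)
  refine (inner_eigenH_eigenPath l k (y l) t).trans ?_
  split_ifs with h <;> simp [h]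

/-! ### Existence for the Stokes evolution equation -/

lemma energy_le_of_isPrimitive (hT : 0 ≤ T) {f : L2Time T H} {k : NZFreq} {y : ℝ → ℝ}
    (hy : IsPrimitive T y fun t => modeL2 hT f k t - eigenvalue k * y t) {t : ℝ}
    (ht : t ∈ Icc 0 T) : eigenvalue k * y t ^ 2 + ∫ s in 0..t, (eigenvalue k * y s) ^ 2
      ≤ eigenvalue k * y 0 ^ 2 + ∫ t, inner ℝ (eigenH k) (f t) ^ 2 ∂timeMeasure T := by
  have hsq := intervalIntegrable_modeL2_sq hT f k
  refine (scalar_energy_le hT hy hsq ht).trans (add_le_add_right ?_ _)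
  simp only [← modeL2_coe hT]
  rw [integral_timeMeasure hT fun t => modeL2 hT f k t ^ 2]
  exact intervalIntegral.integral_mono_interval le_rfl ht.1 ht.2
    (ae_of_all _ fun _ => sq_nonneg _) hsq

lemma exists_isStokesSolution (hT : 0 ≤ T) (f : L2Time T H) (ω₀ : V) :
    ∃ ω : X T, ω.path ⟨0, left_mem_Icc.2 hT⟩ = ω₀ ∧ IsStokesSolution f ω := by
  choose y hy0 hy using fun k : NZFreq => exists_scalar_solution hT
    (intervalIntegrable_modeL2 hT f k) (eigenvalue k) (inner ℝ (eigenH k) (V.toH ω₀))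
  let yc (k : NZFreq) : C(Icc (0 : ℝ) T, ℝ) :=
    ⟨fun t => y k t, continuousOn_iff_continuous_domRestrict.1 ((hy k).continuousOn hT)⟩
  have henergy (k : NZFreq) {t : ℝ} (ht : t ∈ Icc 0 T) := energy_le_of_isPrimitive hT (hy k) ht
  simp only [hy0] at henergy
  have hsum : Summable fun k => eigenPath k (yc k) := by
    refine summable_eigenPath
      ((summable_eigenvalue_mul_sq ω₀).add (hasSum_integral_sq f).summable)
      (fun (k : NZFreq) t => ?_) fun (k : NZFreq) => ?_
    · refine (le_add_of_nonneg_right ?_).trans (henergy k t.2)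
      exact intervalIntegral.integral_nonneg t.2.1 fun _ _ => sq_nonneg _
    · have hend := henergy k (right_mem_Icc.2 hT)
      rw [← integral_timeMeasure hT] at hend
      refine (le_add_of_nonneg_left ?_).trans hend
      exact mul_nonneg (eigenvalue_nonneg k) (sq_nonneg _)
  refine ⟨∑' k, eigenPath k (yc k), V.toH_injective (ext_inner_eigenH fun k => ?_),
    (isStokesSolution_iff hT).2 fun k => ?_⟩
  · rw [← mode_coe hT, mode_tsum_eigenPath hT hsum]
    exact hy0 k
  · have hmode : EqOn (y k) (mode hT (∑' l, eigenPath l (yc l)) k) (Icc 0 T) := fun t ht =>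
      (mode_tsum_eigenPath hT hsum k ⟨t, ht⟩).symm
    exact (hy k).congr hT hmode fun t ht => by simp only [hmode ht]

/-! ### Uniqueness for the Stokes evolution equation -/

lemma E.toV_injective : Function.Injective E.toV := by
  refine (injective_iff_map_eq_zero _).2 fun u hu => ?_
  have htoH : E.toH u = 0 := (congrArg V.toH hu).trans (map_zero _)
  have hA : A u = 0 := ext_inner_eigenH fun k => by
    rw [inner_eigenH_A, htoH, inner_zero_right, mul_zero]
  have hnorm := norm_le_norm_A u
  rwa [hA, norm_zero, mul_zero, norm_le_zero_iff] at hnorm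

lemma X.path_injective : Function.Injective (X.path : X T → C(Icc (0 : ℝ) T, V)) := by
  intro ω ω' h
  refine Subtype.ext (Prod.ext h (Lp.ext ?_))
  filter_upwards [ω.toV_toE_ae_eq, ω'.toV_toE_ae_eq] with t hω hω'
  exact E.toV_injective (hω.trans ((DFunLike.congr_fun h t).trans hω'.symm))

lemma IsStokesSolution.eq_zero (hT : 0 ≤ T) {ω : X T} (h : IsStokesSolution 0 ω)
    (h0 : ω.path ⟨0, left_mem_Icc.2 hT⟩ = 0) : ω = 0 := by
  refine X.path_injective (ContinuousMap.ext fun t => V.toH_injective ?_)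
  refine ext_inner_eigenH fun k => ?_
  have henergy := energy_le_of_isPrimitive hT ((isStokesSolution_iff hT).1 h k) t.2
  have hstart : mode hT ω k 0 = 0 := by
    rw [mode, IccExtend_left, h0, map_zero, inner_zero_right]
  have hforce : ∫ t, inner ℝ (eigenH k) ((0 : L2Time T H) t) ^ 2 ∂timeMeasure T ≤ 0 :=
    (le_hasSum (hasSum_integral_sq 0) k fun _ _ => integral_nonneg fun _ => sq_nonneg _).trans
      (by simp)
  have hdissip : 0 ≤ ∫ s in 0..(t : ℝ), (eigenvalue k * mode hT ω k s) ^ 2 :=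
    intervalIntegral.integral_nonneg t.2.1 fun _ _ => sq_nonneg _
  rw [hstart] at henergy
  have hmode : mode hT ω k t ^ 2 ≤ 0 := by
    nlinarith [one_le_eigenvalue k.2, sq_nonneg (mode hT ω k t)]
  rw [← mode_coe hT, ← mode_coe hT, pow_eq_zero_iff two_ne_zero |>.1 (hmode.antisymm (sq_nonneg _))]
  exact (inner_zero_right _).symm

/-! ### The linearized equation on a bounded interval -/

/-- The lower order part of the linearized operator along `ω ∈ X_T`. -/
abbrev lowerOrderPath (ubar : E) (ω : X T) : L2Time T H :=
  (lowerOrder ubar).compLpL 2 (timeMeasure T) ω.toE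

lemma isLinearizedSolution_iff {ubar : E} {hT : 0 < T} {U : L2Time T H} {ω₀ : V} {ω : X T} :
    IsLinearizedSolution ubar hT U ω₀ ω ↔
      ω.path ⟨0, left_mem_Icc.2 hT.le⟩ = ω₀ ∧ IsStokesSolution (U + lowerOrderPath ubar ω) ω := by
  refine and_congr_right fun _ => exists_congr fun w => and_congr_right fun _ => ?_
  refine Filter.eventually_congr ?_
  filter_upwards [Lp.coeFn_add U (lowerOrderPath ubar ω),
    (lowerOrder ubar).coeFn_compLpL (p := 2) ω.toE] with t hadd hcomp
  rw [hadd, Pi.add_apply, hcomp, lowerOrder_apply, ← sub_eq_zero,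
    ← sub_eq_zero (a := w t + A (ω.toE t))]
  refine Eq.congr_left ?_
  abel

lemma norm_weight_lowerOrderPath_le {ubar : E} {μ : ℝ}
    (hμ : ∀ ω, ‖lowerOrder ubar ω‖ ≤ 2⁻¹ * ‖shiftedA μ ω‖) (ω : X T) :
    ‖weight μ (lowerOrderPath ubar ω)‖ ≤ 2⁻¹ * ‖weight μ (shiftedPath μ ω)‖ := by
  refine norm_weight_le μ ?_
  filter_upwards [(lowerOrder ubar).coeFn_compLpL (p := 2) ω.toE,
    (shiftedA μ).coeFn_compLpL (p := 2) ω.toE] with t hlower hshifted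
  rw [hlower, hshifted]
  exact hμ _

lemma norm_weight_lowerOrderPath_sub_le (hT : 0 ≤ T) {ubar : E} {μ : ℝ} (hμ : 0 ≤ μ)
    (hlower : ∀ ω, ‖lowerOrder ubar ω‖ ≤ 2⁻¹ * ‖shiftedA μ ω‖) {f f' : L2Time T H} {ω ω' : X T}
    (h : IsStokesSolution f ω) (h' : IsStokesSolution f' ω')
    (h0 : ω.path ⟨0, left_mem_Icc.2 hT⟩ = ω'.path ⟨0, left_mem_Icc.2 hT⟩) :
    ‖weight μ (lowerOrderPath ubar ω) - weight μ (lowerOrderPath ubar ω')‖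
      ≤ 2⁻¹ * ‖weight μ f - weight μ f'‖ := by
  rw [← weight_sub, ← weight_sub, ← map_sub, ← X.toE_sub]
  have hstart : (ω - ω').path ⟨0, left_mem_Icc.2 hT⟩ = 0 := by rw [X.path_sub, h0, sub_self]
  linarith [norm_weight_lowerOrderPath_le hlower (ω - ω'),
    (h.sub h').norm_weight_shiftedPath_le hT hstart hμ]

lemma linearizedSolution_unique {ubar : E} {hT : 0 < T} {U : L2Time T H} {ω₀ : V} {ω ω' : X T}
    (h : IsLinearizedSolution ubar hT U ω₀ ω) (h' : IsLinearizedSolution ubar hT U ω₀ ω') :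
    ω = ω' := by
  obtain ⟨μ, hμ, hlower⟩ := exists_norm_lowerOrder_le ubar
  obtain ⟨hstart, hsol⟩ := isLinearizedSolution_iff.1 h
  obtain ⟨hstart', hsol'⟩ := isLinearizedSolution_iff.1 h'
  have hcontr := norm_weight_lowerOrderPath_sub_le hT.le hμ hlower hsol hsol'
    (hstart.trans hstart'.symm)
  rw [← weight_sub, ← weight_sub, add_sub_add_left_eq_sub, weight_sub] at hcontr
  have hpath : lowerOrderPath ubar ω = lowerOrderPath ubar ω' :=
    weight_injective μ (sub_eq_zero.1 (norm_le_zero_iff.1 (by linarith)))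
  have hdiff := hsol.sub hsol'
  rw [hpath, sub_self] at hdiff
  exact sub_eq_zero.1 (hdiff.eq_zero hT.le (by rw [X.path_sub, hstart, hstart', sub_self]))

lemma exists_linearizedSolution (ubar : E) (hT : 0 < T) (U : L2Time T H) (ω₀ : V) :
    ∃ ω : X T, IsLinearizedSolution ubar hT U ω₀ ω := by
  obtain ⟨μ, hμ, hlower⟩ := exists_norm_lowerOrder_le ubar
  choose sol hstart hsol using fun f : L2Time T H => exists_isStokesSolution hT.le f ω₀
  let Φ (g : L2Time T H) : L2Time T H :=
    weight μ (U + lowerOrderPath ubar (sol (weight (-μ) g)))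
  have hΦ : ContractingWith 2⁻¹ Φ := by
    refine ⟨by rw [← NNReal.coe_lt_coe]; norm_num, LipschitzWith.of_dist_le_mul fun g g' => ?_⟩
    have hcontr := norm_weight_lowerOrderPath_sub_le hT.le hμ hlower (hsol (weight (-μ) g))
      (hsol (weight (-μ) g')) ((hstart _).trans (hstart _).symm)
    rw [weight_weight_neg, weight_weight_neg] at hcontr
    rwa [dist_eq_norm, dist_eq_norm, ← weight_sub, add_sub_add_left_eq_sub, weight_sub]
  have : Nonempty (L2Time T H) := ⟨0⟩
  obtain ⟨g, hg⟩ : ∃ g, Φ g = g := ⟨_, hΦ.fixedPoint_isFixedPt⟩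
  have hforce : U + lowerOrderPath ubar (sol (weight (-μ) g)) = weight (-μ) g :=
    weight_injective μ (by rw [weight_weight_neg]; exact hg)
  refine ⟨sol (weight (-μ) g), isLinearizedSolution_iff.2 ⟨hstart _, ?_⟩⟩
  rw [hforce]
  exact hsol _

lemma existsUnique_linearizedSolution (ubar : E) (hT : 0 < T) (U : L2Time T H) (ω₀ : V) :
    ∃! ω : X T, IsLinearizedSolution ubar hT U ω₀ ω :=
  existsUnique_of_exists_of_unique (exists_linearizedSolution ubar hT U ω₀)
    fun _ _ h h' => linearizedSolution_unique h h'

end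

/-! ### Restriction in time -/

section

variable {T T₂ : ℝ} (h : T ≤ T₂)

/-- The inclusion of `[0, T]` into `[0, T₂]`. -/
abbrev timeIncl : C(Icc (0 : ℝ) T, Icc (0 : ℝ) T₂) :=
  ⟨inclusion (Icc_subset_Icc_right h), continuous_inclusion _⟩

lemma map_timeIncl_le : (timeMeasure T).map (timeIncl h) ≤ timeMeasure T₂ := by
  refine Measure.le_iff.2 fun s hs => ?_
  rw [Measure.map_apply (timeIncl h).measurable hs,
    (MeasurableEmbedding.subtype_coe measurableSet_Icc).comap_apply,
    (MeasurableEmbedding.subtype_coe measurableSet_Icc).comap_apply]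
  refine measure_mono ?_
  rintro _ ⟨x, hx, rfl⟩
  exact ⟨timeIncl h x, hx, rfl⟩

lemma quasiMeasurePreserving_timeIncl :
    Measure.QuasiMeasurePreserving (timeIncl h) (timeMeasure T) (timeMeasure T₂) :=
  ⟨(timeIncl h).measurable, Measure.absolutelyContinuous_of_le (map_timeIncl_le h)⟩

lemma memLp_timeIncl {F : Type} [NormedAddCommGroup F] (f : L2Time T₂ F) :
    MemLp (fun t => f (timeIncl h t)) 2 (timeMeasure T) :=
  ((Lp.memLp f).mono_measure (map_timeIncl_le h)).comp_of_map
    (timeIncl h).measurable.aemeasurable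

/-- The restriction of an element of `L²(0, T₂; F)` to `[0, T]`. -/
def restrictLp {F : Type} [NormedAddCommGroup F] (f : L2Time T₂ F) : L2Time T F :=
  (memLp_timeIncl h f).toLp _

lemma coeFn_restrictLp {F : Type} [NormedAddCommGroup F] (f : L2Time T₂ F) :
    ∀ᵐ t ∂timeMeasure T, restrictLp h f t = f (timeIncl h t) :=
  (memLp_timeIncl h f).coeFn_toLp

/-- The restriction of an element of `X_T₂` to `[0, T]`. -/
def X.restrict (ω : X T₂) : X T :=
  ⟨(ω.path.comp (timeIncl h), restrictLp h ω.toE), by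
    change ∀ᵐ t ∂timeMeasure T, E.toV (restrictLp h ω.toE t) = ω.path (timeIncl h t)
    filter_upwards [coeFn_restrictLp h ω.toE,
      (quasiMeasurePreserving_timeIncl h).ae ω.toV_toE_ae_eq] with t hrestrict hω
    rw [hrestrict, hω]⟩

lemma X.path_restrict (ω : X T₂) (t : Icc (0 : ℝ) T) :
    (ω.restrict h).path t = ω.path (timeIncl h t) := rfl

lemma X.toE_restrict (ω : X T₂) : (ω.restrict h).toE = restrictLp h ω.toE := rfl

lemma setIntegral_restrictLp (f : L2Time T₂ H) {s t : Icc (0 : ℝ) T} (hst : s ≤ t) :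
    ∫ r in Ioc s t, restrictLp h f r ∂timeMeasure T
      = ∫ r in Ioc (timeIncl h s) (timeIncl h t), f r ∂timeMeasure T₂ := by
  let g : ℝ → H := IccExtend ((s.2.1.trans s.2.2).trans h) f
  have hg (r : Icc (0 : ℝ) T₂) : g r = f r := IccExtend_val ..
  calc ∫ r in Ioc s t, restrictLp h f r ∂timeMeasure T
      = ∫ r in Ioc s t, g r ∂timeMeasure T := by
        refine integral_congr_ae (ae_restrict_of_ae ?_)
        filter_upwards [coeFn_restrictLp h f] with r hr
        exact hr.trans (hg (timeIncl h r)).symm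
    _ = ∫ r in (s : ℝ)..t, g r := setIntegral_timeMeasure g hst
    _ = ∫ r in Ioc (timeIncl h s) (timeIncl h t), g r ∂timeMeasure T₂ :=
        (setIntegral_timeMeasure g (s := timeIncl h s) (t := timeIncl h t) hst).symm
    _ = _ := by simp only [hg]

lemma IsLinearizedSolution.restrict {ubar : E} (hT : 0 < T) {hT₂ : 0 < T₂} {U : L2Time T H}
    {U₂ : L2Time T₂ H} (hU : ∀ᵐ t ∂timeMeasure T, U₂ (timeIncl h t) = U t) {ω₀ : V} {ω : X T₂}
    (hω : IsLinearizedSolution ubar hT₂ U₂ ω₀ ω) :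
    IsLinearizedSolution ubar hT U ω₀ (ω.restrict h) := by
  obtain ⟨hstart, w, hderiv, heq⟩ := hω
  refine ⟨hstart, restrictLp h w, fun s t hst => ?_, ?_⟩
  · rw [setIntegral_restrictLp h w hst]
    exact hderiv (timeIncl h s) (timeIncl h t) hst
  · filter_upwards [(quasiMeasurePreserving_timeIncl h).ae heq, hU, coeFn_restrictLp h w,
      coeFn_restrictLp h ω.toE] with t heqt hUt hwt hωt
    rw [hwt, X.toE_restrict, hωt, heqt, hUt]

end

/-! ### The linearized equation on the half line -/

lemma exists_continuousMap_Ici {F : Type*} [TopologicalSpace F]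
    (p : ∀ T : ℝ, 0 < T → C(Icc (0 : ℝ) T, F))
    (hp : ∀ (T T₂ : ℝ) (hT : 0 < T) (hT₂ : 0 < T₂) (h : T ≤ T₂) (t : Icc (0 : ℝ) T),
      p T₂ hT₂ (timeIncl h t) = p T hT t) :
    ∃ v : C(Ici (0 : ℝ), F), ∀ (T : ℝ) (hT : 0 < T) (t : Icc (0 : ℝ) T),
      p T hT t = v ⟨t, t.2.1⟩ := by
  let S (T : Ioi (0 : ℝ)) : Set (Ici (0 : ℝ)) := {t | (t : ℝ) ≤ T}
  let φ (T : Ioi (0 : ℝ)) : C(S T, F) := (p T T.2).comp ⟨fun t => ⟨t, t.1.2, t.2⟩, by fun_prop⟩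
  have hφ (T T₂ : Ioi (0 : ℝ)) (t : Ici (0 : ℝ)) (ht : t ∈ S T) (ht₂ : t ∈ S T₂) :
      φ T ⟨t, ht⟩ = φ T₂ ⟨t, ht₂⟩ := by
    rcases le_total (T : ℝ) T₂ with hle | hle
    · exact (hp T T₂ T.2 T₂.2 hle ⟨t, t.2, ht⟩).symm
    · exact hp T₂ T T₂.2 T.2 hle ⟨t, t.2, ht₂⟩
  have hS (t : Ici (0 : ℝ)) : ∃ T, S T ∈ nhds t :=
    ⟨⟨t + 1, mem_Ioi.2 (add_pos_of_nonneg_of_pos t.2 one_pos)⟩,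
      continuous_subtype_val.continuousAt.preimage_mem_nhds (Iic_mem_nhds (lt_add_one _))⟩
  refine ⟨ContinuousMap.liftCover S φ hφ hS, fun T hT t => ?_⟩
  let t' : S ⟨T, hT⟩ := ⟨⟨t, t.2.1⟩, t.2.2⟩
  exact (ContinuousMap.liftCover_coe (S := S) (hφ := hφ) (hS := hS) t').symm

lemma existsUnique_linearizedSolution_Ici (ubar : E) (U : ℝ → H)
    (hU : ∀ T : ℝ, MemLp (fun t : Icc (0 : ℝ) T => U t) 2 (timeMeasure T)) (ω₀ : V) :
    ∃! ω : C(Ici (0 : ℝ), V), ∀ (T : ℝ) (hT : 0 < T), ∃ ωT : X T,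
      (∀ t : Icc (0 : ℝ) T, ωT.path t = ω ⟨t, t.2.1⟩) ∧
      IsLinearizedSolution ubar hT (hU T).toLp ω₀ ωT := by
  choose sol hsol using fun (T : ℝ) (hT : 0 < T) =>
    exists_linearizedSolution ubar hT (hU T).toLp ω₀
  have hcompat (T T₂ : ℝ) (hT : 0 < T) (hT₂ : 0 < T₂) (h : T ≤ T₂) (t : Icc (0 : ℝ) T) :
      (sol T₂ hT₂).path (timeIncl h t) = (sol T hT).path t := by
    have hUeq : ∀ᵐ t ∂timeMeasure T, (hU T₂).toLp _ (timeIncl h t) = (hU T).toLp _ t := by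
      filter_upwards [(quasiMeasurePreserving_timeIncl h).ae (hU T₂).coeFn_toLp,
        (hU T).coeFn_toLp] with t hlarge hsmall
      exact hlarge.trans hsmall.symm
    rw [← linearizedSolution_unique ((hsol T₂ hT₂).restrict h hT hUeq) (hsol T hT),
      X.path_restrict]
  obtain ⟨v, hv⟩ := exists_continuousMap_Ici (fun T hT => (sol T hT).path) hcompat
  refine ⟨v, fun T hT => ⟨sol T hT, hv T hT, hsol T hT⟩, fun ω hω => ContinuousMap.ext fun t => ?_⟩
  have hpos : (0 : ℝ) < t + 1 := add_pos_of_nonneg_of_pos t.2 one_pos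
  obtain ⟨ωT, hpath, hωT⟩ := hω (t + 1) hpos
  rw [linearizedSolution_unique hωT (hsol _ hpos)] at hpath
  have ht : (t : ℝ) ∈ Icc 0 ((t : ℝ) + 1) := ⟨t.2, by linarith⟩
  exact (hpath ⟨t, ht⟩).symm.trans (hv _ hpos ⟨t, ht⟩)

end CNS

end

theorem mainTheorem2_general :
    (∀ u v : E, MemLp (convection (E.toV u) (E.toV v)) 2 torusMeasure) ∧
    (∃ C₁ C₂ C₃ : ℝ, 0 < C₁ ∧ 0 < C₂ ∧ 0 < C₃ ∧
      ∀ (ubar : E) (T : ℝ) (U : L2Time T H),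
        ∃ Φ : X T → L2Time T H,
          (∀ ω : X T, ∀ᵐ t ∂timeMeasure T, Φ ω t = G ubar (U t) (ω.toE t)) ∧
          ∀ ω₁ ω₂ : X T, ‖Φ ω₁ - Φ ω₂‖ ≤
            (C₁ * ‖E.grad ubar‖ ^ 2 + C₂ * ‖ubar‖
              + 2 * C₃ * ‖E.toH ubar‖ * ‖E.grad ubar‖) * ‖ω₁ - ω₂‖) ∧
    (∀ (ubar : E) (T : ℝ) (hT : 0 < T) (U : L2Time T H) (ω₀ : V),
      ∃! ω : X T, IsLinearizedSolution ubar hT U ω₀ ω) ∧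
    (∀ (ubar : E) (U : ℝ → H)
      (hU : ∀ T : ℝ, MemLp (fun t : Icc (0 : ℝ) T => U t) 2 (timeMeasure T)) (ω₀ : V),
      ∃! ω : C(Ici (0 : ℝ), V), ∀ (T : ℝ) (hT : 0 < T), ∃ ωT : X T,
        (∀ t : Icc (0 : ℝ) T, ωT.path t = ω ⟨t, t.2.1⟩) ∧
        IsLinearizedSolution ubar hT (hU T).toLp ω₀ ωT) := by
  refine ⟨memLp_convection, ?_, fun ubar T hT => existsUnique_linearizedSolution ubar hT,
    existsUnique_linearizedSolution_Ici⟩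
  refine ⟨1, 4 * ‖E.toLinfty‖ + 1, 1, one_pos, by positivity, one_pos, fun ubar T U => ?_⟩
  obtain ⟨Φ, hΦ, hlip⟩ := exists_lipschitz_G ubar U
  refine ⟨Φ, hΦ, fun ω₁ ω₂ => (hlip ω₁ ω₂).trans ?_⟩
  gcongr
  linarith [opNorm_lowerOrder_le ubar, norm_nonneg ubar]

theorem mainTheorem2 :
    -- the products `(u · ∇) v` of elements of `E` are square integrable
    (∀ u v : E, MemLp (convection (E.toV u) (E.toV v)) 2 torusMeasure) ∧
    -- `ω ↦ G(ω)` is globally Lipschitz from `X_T` to `L²(0, T; H)`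
    (∃ C₁ C₂ C₃ : ℝ, 0 < C₁ ∧ 0 < C₂ ∧ 0 < C₃ ∧
      ∀ ubar : E, IsSteadyState ubar → ∀ T : ℝ, 0 < T → ∀ U : L2Time T H,
        ∃ Φ : X T → L2Time T H,
          (∀ ω : X T, ∀ᵐ t ∂timeMeasure T, Φ ω t = G ubar (U t) (ω.toE t)) ∧
          ∀ ω₁ ω₂ : X T, ‖Φ ω₁ - Φ ω₂‖ ≤
            (C₁ * ‖E.grad ubar‖ ^ 2 + C₂ * ‖ubar‖
              + 2 * C₃ * ‖E.toH ubar‖ * ‖E.grad ubar‖) * ‖ω₁ - ω₂‖) ∧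
    -- unique solution on `[0, T]`, for every `T > 0`
    (∀ ubar : E, IsSteadyState ubar → ∀ (T : ℝ) (hT : 0 < T) (U : L2Time T H) (ω₀ : V),
      ∃! ω : X T, IsLinearizedSolution ubar hT U ω₀ ω) ∧
    -- unique solution on `[0, ∞)`, for a forcing that is square integrable on bounded intervals
    (∀ ubar : E, IsSteadyState ubar → ∀ (U : ℝ → H)
      (hU : ∀ T : ℝ, MemLp (fun t : Icc (0 : ℝ) T => U t) 2 (timeMeasure T)) (ω₀ : V),
      ∃! ω : C(Ici (0 : ℝ), V), ∀ (T : ℝ) (hT : 0 < T), ∃ ωT : X T,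
        (∀ t : Icc (0 : ℝ) T, ωT.path t = ω ⟨t, t.2.1⟩) ∧
        IsLinearizedSolution ubar hT (hU T).toLp ω₀ ωT) := by
  obtain ⟨hconvection, ⟨C₁, C₂, C₃, hC₁, hC₂, hC₃, hlip⟩, hbounded, hglobal⟩ := mainTheorem2_general
  exact ⟨hconvection, ⟨C₁, C₂, C₃, hC₁, hC₂, hC₃, fun ubar _ T _ => hlip ubar T⟩,
    fun ubar _ => hbounded ubar, fun ubar _ => hglobal ubar⟩
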